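/- Let $M$, $N$ be (finite-dimensional) real-analytic manifolds endowed with real-analytic connections $\nabla^M$, $\nabla^N$ on their tangent bundles (not assumed symmetric), with torsion tensors $T^M$, $T^N$, where $T(X,Y)=\nabla_XY-\nabla_YX-[X,Y]$, and curvature tensors $R^M$, $R^N$, where $R(X,Y)Z=\nabla_X\nabla_YZ-\nabla_Y\nabla_XZ-\nabla_{[X,Y]}Z$. For a tensor field $\tau$ let $\nabla^{(0)}\tau=\tau$ and let $\nabla^{(r)}\tau$ be its $r$-th covariant derivative. Let $x_0\in M$, $y_0\in N$ and let $\sigma_0:T_{x_0}M\to T_{y_0}N$ be a linear map. Assume that for every $r\ge 0$ the map $\sigma_0$ relates $\nabla^{(r)}T^M_{x_0}$ with $\nabla^{(r)}T^N_{y_0}$ and $\nabla^{(r)}R^M_{x_0}$ with $\nabla^{(r)}R^N_{y_0}$, that is, $$\sigma_0\big(\nabla^{(r)}T^M_{x_0}(v_1,\dots,v_{r+2})\big)=\nabla^{(r)}T^N_{y_0}(\sigma_0v_1,\dots,\sigma_0v_{r+2}),$$ $$\sigma_0\big(\nabla^{(r)}R^M_{x_0}(v_1,\dots,v_{r+2})v_{r+3}\big)=\nabla^{(r)}R^N_{y_0}(\sigma_0v_1,\dots,\sigma_0v_{r+2})\,\sigma_0v_{r+3}$$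 for all $v_1,\dots,v_{r+3}\in T_{x_0}M$. Then there exist an open neighborhood $U$ of $x_0$ in $M$ and a real-analytic affine map $f:U\to N$ with $f(x_0)=y_0$ and $\mathrm df(x_0)=\sigma_0$. Here a smooth map $f:U\to N$ is called affine if $\mathrm df_x(\nabla^M_vX)=\nabla^N_v(\mathrm df\circ X)$ for every $x\in U$, $v\in T_xM$ and every smooth vector field $X$ on $U$, where $\mathrm df\circ X$ is regarded as a vector field along $f$ and $\nabla^N_v$ on the right-hand side denotes the pull-back connection $f^*\nabla^N$ acting on it. -/

import Mathlib

open scoped Manifold ContDiff Topology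
open Bundle

noncomputable section

namespace AffineConn

variable {E : Type*} [NormedAddCommGroup E] [NormedSpace ℝ E] [FiniteDimensional ℝ E]
  {M : Type*} [TopologicalSpace M] [ChartedSpace E M] [IsManifold 𝓘(ℝ, E) ω M]
  {F : Type*} [NormedAddCommGroup F] [NormedSpace ℝ F] [FiniteDimensional ℝ F]
  {N : Type*} [TopologicalSpace N] [ChartedSpace F N] [IsManifold 𝓘(ℝ, F) ω N]

variable (E M) in
/-- A (linear) connection on the (tangent bundle of the) manifold `M`. As in Mathlib,
`cov X x v` is the covariant derivative `∇_v X` at `x`. -/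
abbrev Connection := CovariantDerivative 𝓘(ℝ, E) E (TangentSpace 𝓘(ℝ, E) : M → Type _)

/-- A connection is real-analytic if over every open set it maps real-analytic vector fields `X`
to real-analytic sections `∇X` of `Hom(TM, TM)`. (The condition is imposed on all open sets because
there might be few global real-analytic vector fields.) -/
def Connection.IsAnalytic (cov : Connection E M) : Prop :=
  ∀ U : Set M, IsOpen U → ContMDiffCovariantDerivativeOn E ω cov.toFun U

variable (E M) in
/-- Fields of `k`-linear maps `T_xM × ⋯ × T_xM → T_xM` (tangent-vector valued tensors),
seen as plain functions. -/
abbrev TensorField (k : ℕ) : Type _ :=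
  ∀ x : M, (Fin k → TangentSpace 𝓘(ℝ, E) x) → TangentSpace 𝓘(ℝ, E) x

/-- The torsion tensor `T(v₀, v₁)`. -/
def torsionField (cov : Connection E M) : TensorField E M 2 :=
  haveI : CompleteSpace E := FiniteDimensional.complete ℝ E
  fun x v ↦ cov.torsion x (v 0) (v 1)

/-- The expression `∇_X ∇_Y Z - ∇_Y ∇_X Z - ∇_[X,Y] Z` at the point `x`. -/
def curvatureAux (cov : Connection E M) (X Y Z : ∀ x : M, TangentSpace 𝓘(ℝ, E) x) (x : M) :
    TangentSpace 𝓘(ℝ, E) x :=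
  cov (fun y ↦ cov Z y (Y y)) x (X x) - cov (fun y ↦ cov Z y (X y)) x (Y x)
    - cov Z x (VectorField.mlieBracket 𝓘(ℝ, E) X Y x)

/-- The curvature tensor `R(v₀, v₁) v₂`. The defining expression is evaluated on the extensions of
the `vᵢ` to vector fields that are constant in the preferred trivialization at `x` (hence
real-analytic near `x`); by tensoriality, any other extensions give the same value. -/
def curvatureField (cov : Connection E M) : TensorField E M 3 :=
  fun x v ↦ curvatureAux cov (FiberBundle.extend E (v 0)) (FiberBundle.extend E (v 1))
    (FiberBundle.extend E (v 2)) x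

/-- The covariant derivative of a tensor field, the direction of differentiation being the first
argument:
`(∇τ)(v₀, …, vₖ) = ∇_{v₀} (τ(X₁, …, Xₖ)) - ∑ᵢ τ(v₁, …, ∇_{v₀} Xᵢ, …, vₖ)`,
where `Xᵢ` is the extension of `vᵢ` to a vector field that is constant in the preferred
trivialization at `x`; by tensoriality, any other extensions give the same value. -/
def nabla (cov : Connection E M) {k : ℕ} (τ : TensorField E M k) : TensorField E M (k + 1) :=
  fun x v ↦ cov (fun y ↦ τ y (fun i ↦ FiberBundle.extend E (v i.succ) y)) x (v 0)
    - ∑ i : Fin k, τ x (Function.update (fun j ↦ v j.succ) i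
        (cov (FiberBundle.extend E (v i.succ)) x (v 0)))

/-- The `r`-th covariant derivative `∇^{(r)} τ`, with `∇^{(0)} τ = τ`. -/
def iterNabla (cov : Connection E M) {k : ℕ} (τ : TensorField E M k) :
    (r : ℕ) → TensorField E M (k + r)
  | 0 => τ
  | r + 1 => nabla cov (iterNabla cov τ r)

/-- A linear map `σ : T_xM → T_yN` relates the tensor `τ` at `x` with the tensor `τ'` at `y`. -/
def Relates {x : M} {y : N} (σ : TangentSpace 𝓘(ℝ, E) x →ₗ[ℝ] TangentSpace 𝓘(ℝ, F) y) {k : ℕ}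
    (τ : TensorField E M k) (τ' : TensorField F N k) : Prop :=
  ∀ v : Fin k → TangentSpace 𝓘(ℝ, E) x, σ (τ x v) = τ' y (fun i ↦ σ (v i))

/-- The pull-back connection: the covariant derivative `∇_v s`, for `v ∈ T_xM`, of a vector field
`s` along `f : M → N`. In the local frame `(eᵢ)` of `TN` given by the preferred trivialization at
`f x` we have `s = ∑ sⁱ (eᵢ ∘ f)` near `x`, and
`∇_v s = ∑ dsⁱ(v) eᵢ(f x) + ∑ sⁱ(x) ∇_{df(v)} eᵢ`;
note that `∑ sⁱ(x) eᵢ` is `FiberBundle.extend F (s x)`. -/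
def covAlong (cov : Connection F N) (f : M → N) (s : ∀ x : M, TangentSpace 𝓘(ℝ, F) (f x))
    (x : M) (v : TangentSpace 𝓘(ℝ, E) x) : TangentSpace 𝓘(ℝ, F) (f x) :=
  (trivializationAt F (TangentSpace 𝓘(ℝ, F) : N → Type _) (f x)).symmL ℝ (f x)
      (mvfderiv 𝓘(ℝ, E) (fun x' : M ↦
        ((trivializationAt F (TangentSpace 𝓘(ℝ, F) : N → Type _) (f x)) ⟨f x', s x'⟩).2) x v)
    + cov (FiberBundle.extend F (s x)) (f x) (mfderiv 𝓘(ℝ, E) 𝓘(ℝ, F) f x v)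

/-- `f` restricts to an affine map `U → N`: it is smooth on (the open set) `U`, and
`df(∇_v X) = ∇_v (df ∘ X)` for all smooth vector fields `X` on `U` and all tangent vectors `v`
at points of `U`. -/
structure IsAffineOn (covM : Connection E M) (covN : Connection F N) (f : M → N) (U : Set M) :
    Prop where
  smooth : ContMDiffOn 𝓘(ℝ, E) 𝓘(ℝ, F) ∞ f U
  map_cov : ∀ X : (∀ x : M, TangentSpace 𝓘(ℝ, E) x),
    ContMDiffOn 𝓘(ℝ, E) (𝓘(ℝ, E).prod 𝓘(ℝ, E)) ∞
      (fun x ↦ (⟨x, X x⟩ : TangentBundle 𝓘(ℝ, E) M)) U →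
    ∀ x ∈ U, ∀ v : TangentSpace 𝓘(ℝ, E) x,
      mfderiv 𝓘(ℝ, E) 𝓘(ℝ, F) f x (covM X x v) =
        covAlong covN f (fun y ↦ mfderiv 𝓘(ℝ, E) 𝓘(ℝ, F) f y (X y)) x v

end AffineConn

end

/-! In charts, with Christoffel symbols `Γ` and `Γ'`, a map `f` is affine exactly when the pair `G =
(f, σ)`, `σ = df`, solves the total differential equation `dG = A(x, G)` with `A(x, (y, σ)) v = (σ
v, σ ∘ Γ(v) - Γ'(σ v) ∘ σ)` (`affineSystem`). The Frobenius condition for `A` fails at a general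
`(x, (y, σ))`. It holds wherever `σ` relates the torsions and the curvatures
(`fderiv_affineSystem_symm`), and it is needed only along the graph of a candidate solution.

The candidate solves the equation along the rays from `x₀` (`exists_analyticAt_radial_solution`).
Its analyticity comes from the implicit function theorem in a space of continuous curves: for the
zero direction the right-hand side vanishes, so the linearised problem is the identity.

Along a ray `σ` is parallel. Let `hᵣ` be the defect by which `σ` fails to relate the `r`-th
covariant derivatives of two tensor fields. Then `hᵣ'` is `hᵣ₊₁` with the ray direction inserted,
plus a term linear in `hᵣ` (`hasDerivAt_relationDefect`). The hypothesis says that every `hᵣ(0)` is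
zero. Hence every `hᵣ` vanishes to infinite order, and being analytic it is zero near `0`
(`eventually_eq_zero_of_hierarchy`). For torsion and curvature the case `r = 0` is the integrability
condition along the graph of `G`. Under it, `B = dG - A(x, G)` satisfies a homogeneous linear
inequality along rays and vanishes by Grönwall (`eventually_fderiv_eq_of_radial`).

What remains is to identify the intrinsic torsion, curvature, covariant derivatives and pull-back
connection with their expressions in one fixed chart (`Represents`, `coordAt_covAlong`). -/

noncomputable section

namespace AffineConn

/-! ### Superposition operators on spaces of continuous functions -/

section Superposition

variable {X W Y : Type*} [TopologicalSpace X] [CompactSpace X]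
  [NormedAddCommGroup W] [NormedSpace ℝ W] [NormedAddCommGroup Y] [NormedSpace ℝ Y]

/-- The pointwise action of a continuous multilinear map on continuous functions. -/
def pointwiseMultilinear {n : ℕ} (p : W [×n]→L[ℝ] Y) : C(X, W) [×n]→L[ℝ] C(X, Y) :=
  MultilinearMap.mkContinuous
    { toFun := fun g ↦ ⟨fun t ↦ p (fun i ↦ g i t), by fun_prop⟩
      map_update_add' := by
        intro _ m i x y
        ext t
        have h : ∀ z : C(X, W), (fun j ↦ Function.update m i z j t)
            = Function.update (fun j ↦ m j t) i (z t) := by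
          intro z; ext j; rcases eq_or_ne j i with rfl | hj <;> simp [*]
        simp [h]
      map_update_smul' := by
        intro _ m i c x
        ext t
        have h : ∀ z : C(X, W), (fun j ↦ Function.update m i z j t)
            = Function.update (fun j ↦ m j t) i (z t) := by
          intro z; ext j; rcases eq_or_ne j i with rfl | hj <;> simp [*]
        simp [h] } ‖p‖ (by
    intro g
    refine (ContinuousMap.norm_le _ (by positivity)).2 fun t ↦ ?_
    refine (p.le_opNorm _).trans ?_
    gcongr with i
    exact (g i).norm_coe_le_norm t)

lemma norm_pointwiseMultilinear_le {n : ℕ} (p : W [×n]→L[ℝ] Y) :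
    ‖(pointwiseMultilinear p : C(X, W) [×n]→L[ℝ] C(X, Y))‖ ≤ ‖p‖ :=
  MultilinearMap.mkContinuous_norm_le _ (norm_nonneg _) _

/-- Superposition with an analytic map is analytic on continuous functions with the sup norm, near
a constant function. -/
lemma exists_analyticAt_superposition [CompleteSpace Y] {a : W → Y} {c : W}
    (ha : AnalyticAt ℝ a c) :
    ∃ N : C(X, W) → C(X, Y), AnalyticAt ℝ N (ContinuousMap.const X c) ∧
      ∀ᶠ g in 𝓝 (ContinuousMap.const X c), ∀ t, N g t = a (g t) := by
  obtain ⟨p, r, hp⟩ := ha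
  let P : FormalMultilinearSeries ℝ C(X, W) C(X, Y) := fun n ↦ pointwiseMultilinear (p n)
  have hPr : r ≤ P.radius :=
    hp.r_le.trans (FormalMultilinearSeries.radius_le_of_le fun n ↦ norm_pointwiseMultilinear_le _)
  have hP := P.hasFPowerSeriesOnBall (hp.r_pos.trans_le hPr)
  -- The composite `a ∘ g` need not be continuous for `g` far from `c`, so the operator is taken to
  -- be the sum of the power series and is compared with `a ∘ g` only near `c`.
  refine ⟨fun g ↦ P.sum (g - ContinuousMap.const X c), ?_, ?_⟩
  · have h1 : AnalyticAt ℝ P.sum (ContinuousMap.const X c - ContinuousMap.const X c) := by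
      rw [sub_self]; exact hP.analyticAt
    exact h1.comp_of_eq (f := fun g ↦ g - ContinuousMap.const X c)
      (analyticAt_id.sub analyticAt_const) rfl
  · filter_upwards [Metric.eball_mem_nhds (ContinuousMap.const X c) hp.r_pos] with g hg t
    have hg' : g - ContinuousMap.const X c ∈ Metric.eball (0 : C(X, W)) r := by
      simpa [Metric.mem_eball, edist_eq_enorm_sub] using hg
    have hs := hP.hasSum (Metric.eball_subset_eball hPr hg')
    rw [zero_add] at hs
    have hs' := (ContinuousMap.evalCLM ℝ t).hasSum hs
    have ht : g t - c ∈ Metric.eball (0 : W) r := by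
      rw [Metric.mem_eball, edist_zero_right] at hg' ⊢
      refine lt_of_le_of_lt ?_ hg'
      have := (g - ContinuousMap.const X c).norm_coe_le_norm t
      simpa [← ofReal_norm] using ENNReal.ofReal_le_ofReal this
    have h2 := hp.hasSum ht
    rw [add_sub_cancel] at h2
    exact hs'.unique h2

end Superposition

/-! ### Analytic dependence of ODE solutions on parameters -/

section ParametricODE

variable {P Z : Type*} [NormedAddCommGroup P] [NormedSpace ℝ P]
  [NormedAddCommGroup Z] [NormedSpace ℝ Z]

open unitInterval MeasureTheory

/-- The primitive, vanishing at `0`, of a continuous function on the unit interval. -/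
def primitiveCLM : C(I, Z) →L[ℝ] C(I, Z) :=
  LinearMap.mkContinuous
    { toFun := fun h ↦ ⟨fun t ↦ ∫ s in (0 : ℝ)..t, Set.IccExtend zero_le_one h s, by
        have hc : Continuous (Set.IccExtend (zero_le_one' ℝ) h) := h.continuous.Icc_extend'
        exact (intervalIntegral.continuous_primitive
          (fun a b ↦ hc.intervalIntegrable a b) 0).comp continuous_subtype_val⟩
      map_add' := by
        intro g h
        ext t
        have hg : Continuous (Set.IccExtend (zero_le_one' ℝ) g) := g.continuous.Icc_extend'
        have hh : Continuous (Set.IccExtend (zero_le_one' ℝ) h) := h.continuous.Icc_extend'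
        exact intervalIntegral.integral_add (hg.intervalIntegrable _ _) (hh.intervalIntegrable _ _)
      map_smul' := by
        intro c g
        ext t
        exact intervalIntegral.integral_smul c _ } 1 (by
    intro h
    refine (ContinuousMap.norm_le _ (by positivity)).2 fun t ↦ ?_
    refine (intervalIntegral.norm_integral_le_of_norm_le_const
      (C := ‖h‖) fun s _ ↦ h.norm_coe_le_norm _).trans ?_
    rw [sub_zero, abs_of_nonneg t.2.1, mul_comm]
    exact mul_le_mul_of_nonneg_right t.2.2 (norm_nonneg _))

lemma primitiveCLM_apply (h : C(I, Z)) (t : I) :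
    primitiveCLM h t = ∫ s in (0 : ℝ)..t, Set.IccExtend zero_le_one h s := rfl

/-- A curve paired with a constant parameter, as a linear operation. -/
def paramPair : P × C(I, Z) →L[ℝ] C(I, P × Z) :=
  LinearMap.mkContinuous
    { toFun := fun q ↦ (ContinuousMap.const I q.1).prodMk q.2
      map_add' := fun _ _ ↦ rfl
      map_smul' := fun _ _ ↦ rfl } 1 (by
    intro q
    refine (ContinuousMap.norm_le _ (by positivity)).2 fun t ↦ ?_
    rw [one_mul]
    exact max_le_max le_rfl (q.2.norm_coe_le_norm t))

/-- Analytic dependence on the parameter `p` of the solution on the unit interval of `z' = a(p, z)`,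
`z(0) = z₀`, for parameters close to one for which the right-hand side vanishes. -/
lemma exists_analyticAt_ode_solution [CompleteSpace P] [CompleteSpace Z] {a : P × Z → Z} {p₀ : P}
    {z₀ : Z} (ha : AnalyticAt ℝ a (p₀, z₀)) (ha₀ : ∀ᶠ z in 𝓝 z₀, a (p₀, z) = 0) :
    ∃ ζ : P → C(I, Z), AnalyticAt ℝ ζ p₀ ∧ ζ p₀ = ContinuousMap.const I z₀ ∧
      ∀ᶠ q : P × C(I, Z) in 𝓝 (p₀, ContinuousMap.const I z₀),
        (∀ t : I, q.2 t = z₀ + ∫ s in (0 : ℝ)..t, a (q.1, Set.IccExtend zero_le_one q.2 s))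
          ↔ ζ q.1 = q.2 := by
  obtain ⟨N, hN, hNa⟩ := exists_analyticAt_superposition (X := I) ha
  set c : C(I, Z) := ContinuousMap.const I z₀ with hc
  have hpc : paramPair (p₀, c) = ContinuousMap.const I (p₀, z₀) := rfl
  -- Near `(p₀, c)`, the zeros of `Φ` are the solutions of the integral equation.
  let Φ : P × C(I, Z) → C(I, Z) := fun q ↦ q.2 - c - primitiveCLM (N (paramPair q))
  have hNc : AnalyticAt ℝ (fun q : P × C(I, Z) ↦ N (paramPair q)) (p₀, c) :=
    AnalyticAt.comp (by rw [hpc]; exact hN) ((paramPair (P := P) (Z := Z)).analyticAt (p₀, c))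
  have hΦ : AnalyticAt ℝ Φ (p₀, c) := by
    have h1 : AnalyticAt ℝ (fun q ↦ primitiveCLM (N (paramPair q))) (p₀, c) :=
      AnalyticAt.comp ((primitiveCLM (Z := Z)).analyticAt _) hNc
    exact (analyticAt_snd.sub analyticAt_const).sub h1
  have hNa' : ∀ᶠ q in 𝓝 (p₀, c), ∀ t : I, N (paramPair q) t = a (q.1, q.2 t) := by
    have := paramPair.continuous.tendsto (p₀, c)
    rw [hpc] at this
    exact this.eventually hNa
  have hN0 : ∀ᶠ z in 𝓝 c, N (paramPair (p₀, z)) = 0 := by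
    have h1 : ∀ᶠ z in 𝓝 c, ∀ t : I, a (p₀, z t) = 0 := by
      obtain ⟨ε, hε, h⟩ := Metric.eventually_nhds_iff.1 ha₀
      filter_upwards [Metric.ball_mem_nhds c hε] with z hz t
      exact h (lt_of_le_of_lt (ContinuousMap.dist_apply_le_dist (f := z) (g := c) t) hz)
    have h2 : Filter.Tendsto (fun z : C(I, Z) ↦ (p₀, z)) (𝓝 c) (𝓝 (p₀, c)) :=
      (Continuous.prodMk_right p₀).tendsto c
    filter_upwards [h1, h2.eventually hNa'] with z hz hz'
    ext t
    rw [hz' t]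
    exact hz t
  -- For the parameter `p₀` the integral term vanishes near `c`, so `Φ (p₀, z) = z - c` there and no
  -- linear ODE has to be inverted.
  have hder : fderiv ℝ Φ (p₀, c) ∘L .inr ℝ P C(I, Z) = ContinuousLinearMap.id ℝ C(I, Z) := by
    have h1 : HasFDerivAt (fun z : C(I, Z) ↦ Φ (p₀, z))
        (fderiv ℝ Φ (p₀, c) ∘L .inr ℝ P C(I, Z)) c :=
      HasFDerivAt.comp c hΦ.differentiableAt.hasFDerivAt (hasFDerivAt_prodMk_right p₀ c)
    refine h1.unique (((hasFDerivAt_id c).sub_const c).congr_of_eventuallyEq ?_)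
    filter_upwards [hN0] with z hz
    simp [Φ, hz]
  have hinv : (fderiv ℝ Φ (p₀, c) ∘L .inr ℝ P C(I, Z)).IsInvertible := by
    rw [hder]; exact ⟨ContinuousLinearEquiv.refl ℝ _, rfl⟩
  have hcd : ContDiffAt ℝ ω Φ (p₀, c) := hΦ.contDiffAt
  have hΦ0 : Φ (p₀, c) = 0 := by simp [Φ, hN0.self_of_nhds]
  refine ⟨hcd.implicitFunction (by simp) hinv,
    (hcd.contDiffAt_implicitFunction (by simp) hinv).analyticAt,
    hcd.implicitFunction_apply_self (by simp) hinv, ?_⟩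
  filter_upwards [hNa', hcd.eventually_apply_eq_iff_implicitFunction (by simp) hinv] with q hq hq'
  rw [← hq', hΦ0]
  have : Φ q = 0 ↔ ∀ t, q.2 t = z₀ + primitiveCLM (N (paramPair q)) t := by
    rw [ContinuousMap.ext_iff]
    refine forall_congr' fun t ↦ ?_
    simp only [Φ, ContinuousMap.sub_apply, ContinuousMap.zero_apply, hc, ContinuousMap.const_apply]
    rw [sub_eq_zero, sub_eq_iff_eq_add']
  rw [this]
  refine forall_congr' fun t ↦ ?_
  rw [primitiveCLM_apply]
  have : ∀ s, Set.IccExtend (zero_le_one' ℝ) (N (paramPair q)) s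
      = a (q.1, Set.IccExtend (zero_le_one' ℝ) q.2 s) := fun s ↦ hq _
  simp only [this]

end ParametricODE

/-! ### Solutions of total differential equations along rays -/

section Radial

variable {E W : Type*} [NormedAddCommGroup E] [NormedSpace ℝ E] [CompleteSpace E]
  [NormedAddCommGroup W] [NormedSpace ℝ W] [CompleteSpace W]

open unitInterval

/-- An analytic total differential equation can be solved along the rays from a point. -/
lemma exists_analyticAt_radial_solution {A : E × W → E →L[ℝ] W} {x₀ : E} {w₀ : W}
    (hA : AnalyticAt ℝ A (x₀, w₀)) :
    ∃ G : E → W, AnalyticAt ℝ G x₀ ∧ G x₀ = w₀ ∧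
      ∀ᶠ x in 𝓝 x₀, fderiv ℝ G x (x - x₀) = A (x, G x) (x - x₀) := by
  -- The ray direction is the parameter. Carrying the position as an unknown makes the equation
  -- autonomous, and the direction `0` makes its right-hand side vanish.
  let a : E × (E × W) → E × W := fun q ↦ (q.1, A q.2 q.1)
  have ha : AnalyticAt ℝ a (0, (x₀, w₀)) := by
    have h1 : AnalyticAt ℝ (fun q : E × (E × W) ↦ A q.2) (0, (x₀, w₀)) :=
      AnalyticAt.comp (g := A) hA analyticAt_snd
    exact analyticAt_fst.prod
      (ContDiffAt.clm_apply (n := ω) h1.contDiffAt contDiffAt_fst).analyticAt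
  obtain ⟨ζ, hζ, hζ0, hiff⟩ := exists_analyticAt_ode_solution ha (by simp [a])
  set c : C(I, E × W) := ContinuousMap.const I (x₀, w₀) with hc
  have hAc : ∀ᶠ z in 𝓝 (x₀, w₀), ContinuousAt A z :=
    hA.eventually_analyticAt.mono fun z hz ↦ hz.continuousAt
  obtain ⟨δ, hδ, hAδ⟩ := Metric.eventually_nhds_iff.1 hAc
  obtain ⟨ε, hε, hiff⟩ := Metric.eventually_nhds_iff.1 hiff
  have hζc : ∀ᶠ v in 𝓝 (0 : E), dist (ζ v) c < min ε δ := by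
    have := hζ.continuousAt.tendsto
    rw [hζ0] at this
    exact this.eventually (Metric.ball_mem_nhds c (lt_min hε hδ))
  let good : E → Prop := fun v ↦ ‖v‖ < ε ∧ dist (ζ v) c < min ε δ
  have hgood : ∀ᶠ v in 𝓝 (0 : E), good v := by
    filter_upwards [Metric.ball_mem_nhds (0 : E) hε, hζc] with v hv hv'
    exact ⟨by simpa using hv, hv'⟩
  have hacont : ∀ v, good v → Continuous fun s ↦ a (v, Set.IccExtend (zero_le_one' ℝ) (ζ v) s) := by
    intro v hv
    have h1 : Continuous (Set.IccExtend (zero_le_one' ℝ) (ζ v)) := (ζ v).continuous.Icc_extend'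
    refine continuous_iff_continuousAt.2 fun s ↦ ?_
    refine continuousAt_const.prodMk (ContinuousAt.clm_apply ?_ continuousAt_const)
    refine ContinuousAt.comp (g := A) (hAδ ?_) h1.continuousAt
    exact lt_of_le_of_lt (ContinuousMap.dist_apply_le_dist (f := ζ v) (g := c) _)
      (lt_of_lt_of_le hv.2 (min_le_right _ _))
  have hint : ∀ v, good v → ∀ t : I, ζ v t
      = (x₀, w₀) + ∫ s in (0 : ℝ)..t, a (v, Set.IccExtend zero_le_one (ζ v) s) := by
    intro v hv
    refine (hiff (y := (v, ζ v)) ?_).2 rfl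
    rw [Prod.dist_eq]
    exact max_lt (by simpa using hv.1) (lt_of_lt_of_le hv.2 (min_le_left _ _))
  -- The right-hand side is linear in the direction, so slowing down the curve for `v` by `s` solves
  -- the equation for `s • v`; the uniqueness half of `hiff` identifies the two curves.
  have hscale : ∀ v, good v → ∀ s t : I, ζ ((s : ℝ) • v) t = ζ v (s * t) := by
    intro v hv s t
    let z : C(I, E × W) := (ζ v).comp ⟨fun t ↦ s * t, by fun_prop⟩
    suffices h : ζ ((s : ℝ) • v) = z by rw [h]; rfl
    refine (hiff (y := ((s : ℝ) • v, z)) ?_).1 fun t ↦ ?_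
    · rw [Prod.dist_eq]
      refine max_lt ?_ ?_
      · rw [dist_zero_right, norm_smul]
        refine lt_of_le_of_lt ?_ hv.1
        rw [Real.norm_of_nonneg s.2.1]
        exact mul_le_of_le_one_left (norm_nonneg _) s.2.2
      · refine lt_of_le_of_lt ?_ (lt_of_lt_of_le hv.2 (min_le_left _ _))
        exact (ContinuousMap.dist_le dist_nonneg).2 fun t ↦
          ContinuousMap.dist_apply_le_dist (f := ζ v) (g := c) (s * t)
    · have h1 : z t = ζ v (s * t) := rfl
      rw [h1, hint v hv (s * t)]
      congr 1
      have h2 : ∀ u ∈ Set.uIcc (0 : ℝ) t, a ((s : ℝ) • v, Set.IccExtend zero_le_one z u)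
          = (s : ℝ) • a (v, Set.IccExtend zero_le_one (ζ v) (s * u)) := by
        intro u hu
        rw [Set.uIcc_of_le t.2.1] at hu
        have hu' : u ∈ Set.Icc (0 : ℝ) 1 := ⟨hu.1, hu.2.trans t.2.2⟩
        have hsu : (s : ℝ) * u ∈ Set.Icc (0 : ℝ) 1 := (s * ⟨u, hu'⟩ : I).2
        rw [Set.IccExtend_of_mem _ _ hu', Set.IccExtend_of_mem _ _ hsu]
        have h3 : z ⟨u, hu'⟩ = ζ v ⟨s * u, hsu⟩ := rfl
        rw [h3]
        simp [a]
      rw [intervalIntegral.integral_congr h2, intervalIntegral.integral_smul,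
        intervalIntegral.smul_integral_comp_mul_left
          (f := fun r ↦ a (v, Set.IccExtend zero_le_one (ζ v) r)), mul_zero]
      simp
  have hderiv : ∀ v, good v → ∀ s ∈ Set.Ioo (0 : ℝ) 1,
      HasDerivAt (fun t ↦ ζ v (Set.projIcc 0 1 zero_le_one t))
        (a (v, Set.IccExtend zero_le_one (ζ v) s)) s := by
    intro v hv s hs
    have h1 : HasDerivAt (fun t ↦ (x₀, w₀) + ∫ u in (0 : ℝ)..t,
        a (v, Set.IccExtend zero_le_one (ζ v) u)) (a (v, Set.IccExtend zero_le_one (ζ v) s)) s :=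
      ((hacont v hv).integral_hasStrictDerivAt 0 s).hasDerivAt.const_add _
    refine h1.congr_of_eventuallyEq ?_
    filter_upwards [Icc_mem_nhds hs.1 hs.2] with t ht
    rw [hint v hv, Set.projIcc_of_mem _ ht]
  have hfst : ∀ v, good v → ∀ t : I, (ζ v t).1 = x₀ + (t : ℝ) • v := by
    intro v hv t
    have h1 := ContinuousLinearMap.intervalIntegral_comp_comm (ContinuousLinearMap.fst ℝ E W)
      ((hacont v hv).intervalIntegrable (μ := MeasureTheory.volume) 0 t)
    rw [hint v hv t, Prod.fst_add]
    refine (congrArg (x₀ + ·) h1.symm).trans ?_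
    simp [a]
  let G : E → W := fun x ↦ (ζ (x - x₀) 1).2
  have hGan : AnalyticAt ℝ G x₀ := by
    have h1 : AnalyticAt ℝ (fun x ↦ ζ (x - x₀)) x₀ :=
      hζ.comp_of_eq (analyticAt_id.sub analyticAt_const) (by simp)
    exact AnalyticAt.comp (g := (ContinuousLinearMap.snd ℝ E W) ∘L
      (ContinuousMap.evalCLM ℝ (1 : I))) (ContinuousLinearMap.analyticAt _ _) h1
  refine ⟨G, hGan, by simp [G, hζ0, hc], ?_⟩
  -- The factor `2` puts `x` at time `1 / 2` of its ray, an interior point of the time interval,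
  -- where `hderiv` gives a two-sided derivative.
  have htend : Filter.Tendsto (fun x ↦ (2 : ℝ) • (x - x₀)) (𝓝 x₀) (𝓝 0) := by
    have : Continuous fun x ↦ (2 : ℝ) • (x - x₀) := by fun_prop
    simpa using this.tendsto x₀
  filter_upwards [htend.eventually hgood, hGan.eventually_analyticAt] with x hx hxan
  set v := (2 : ℝ) • (x - x₀) with hv
  have hxv : x₀ + (1 / 2 : ℝ) • v = x := by
    rw [hv, smul_smul]; norm_num
  have hI : (1 / 2 : ℝ) ∈ Set.Ioo (0 : ℝ) 1 := by norm_num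
  have hI' : (1 / 2 : ℝ) ∈ Set.Icc (0 : ℝ) 1 := by norm_num
  have hGs : ∀ s : I, G (x₀ + (s : ℝ) • v) = (ζ v s).2 := by
    intro s
    simp only [G, add_sub_cancel_left]
    rw [hscale v hx, mul_one]
  have hd1 : HasDerivAt (fun s : ℝ ↦ G (x₀ + s • v)) (fderiv ℝ G x v) (1 / 2) := by
    have h1 : HasDerivAt (fun s : ℝ ↦ x₀ + s • v) v (1 / 2) := by
      simpa using ((hasDerivAt_id (1 / 2 : ℝ)).smul_const v).const_add x₀
    have h2 : HasFDerivAt G (fderiv ℝ G x) (x₀ + (1 / 2 : ℝ) • v) := by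
      rw [hxv]; exact hxan.differentiableAt.hasFDerivAt
    exact h2.comp_hasDerivAt _ h1
  have hd2 : HasDerivAt (fun s : ℝ ↦ G (x₀ + s • v)) (A (x, G x) v) (1 / 2) := by
    have h1 := (ContinuousLinearMap.snd ℝ E W).hasFDerivAt.comp_hasDerivAt (1 / 2 : ℝ)
      (hderiv v hx _ hI)
    have h3 : ζ v ⟨1 / 2, hI'⟩ = (x, G x) := by
      refine Prod.ext ?_ ?_
      · rw [hfst v hx]; exact hxv
      · rw [← hGs ⟨1 / 2, hI'⟩, hxv]
    have h4 : (ContinuousLinearMap.snd ℝ E W) (a (v, Set.IccExtend zero_le_one (ζ v) (1 / 2)))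
        = A (x, G x) v := by
      rw [Set.IccExtend_of_mem _ _ hI', h3]; rfl
    rw [h4] at h1
    refine h1.congr_of_eventuallyEq ?_
    filter_upwards [Icc_mem_nhds hI.1 hI.2] with s hs
    rw [Function.comp_apply, Set.projIcc_of_mem _ hs]
    exact hGs ⟨s, hs⟩
  have := hd1.unique hd2
  have hxx : x - x₀ = (1 / 2 : ℝ) • v := by rw [← hxv]; simp
  rw [hxx, (fderiv ℝ G x).map_smul, (A (x, G x)).map_smul, this]

end Radial

/-! ### The Frobenius argument, with integrability required only along the graph -/

section Frobenius

variable {E W : Type*} [NormedAddCommGroup E] [NormedSpace ℝ E]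
  [NormedAddCommGroup W] [NormedSpace ℝ W] [CompleteSpace W]

lemma eventually_norm_lt_norm_add_one {X V : Type*} [TopologicalSpace X] [NormedAddCommGroup V]
    {f : X → V} {x : X} (hf : ContinuousAt f x) : ∀ᶠ y in 𝓝 x, ‖f y‖ < ‖f x‖ + 1 :=
  hf.tendsto.norm.eventually (gt_mem_nhds (lt_add_one ‖f x‖))

/-- A radial solution of a total differential equation that satisfies the integrability condition
along its graph is a solution. -/
lemma eventually_fderiv_eq_of_radial {A : E × W → E →L[ℝ] W} {x₀ : E} {G : E → W}
    (hA : AnalyticAt ℝ A (x₀, G x₀)) (hG : AnalyticAt ℝ G x₀)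
    (hrad : ∀ᶠ x in 𝓝 x₀, fderiv ℝ G x (x - x₀) = A (x, G x) (x - x₀))
    (hobs : ∀ᶠ x in 𝓝 x₀, ∀ u w, fderiv ℝ A (x, G x) (u, A (x, G x) u) w
      = fderiv ℝ A (x, G x) (w, A (x, G x) w) u) :
    ∀ᶠ x in 𝓝 x₀, fderiv ℝ G x = A (x, G x) := by
  let B : E → E →L[ℝ] W := fun x ↦ fderiv ℝ G x - A (x, G x)
  let L : E → E × W →L[ℝ] E →L[ℝ] W := fun x ↦ fderiv ℝ A (x, G x)
  have hgraph : ContinuousAt (fun x ↦ (x, G x)) x₀ := continuousAt_id.prodMk hG.continuousAt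
  have hAev : ∀ᶠ x in 𝓝 x₀, AnalyticAt ℝ A (x, G x) := hgraph.eventually hA.eventually_analyticAt
  have hL : ContinuousAt L x₀ := ContinuousAt.comp (g := fderiv ℝ A) hA.fderiv.continuousAt hgraph
  have hLb : ∀ᶠ x in 𝓝 x₀, ‖L x‖ < ‖L x₀‖ + 1 :=
    @eventually_norm_lt_norm_add_one _ _ _ ContinuousLinearMap.toNormedAddCommGroup _ _ hL
  have hrad' : ∀ᶠ x in 𝓝 x₀, ∀ᶠ y in 𝓝 x, B y (y - x₀) = 0 := by
    refine Filter.Eventually.eventually_nhds (hrad.mono fun x hx ↦ ?_)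
    simp [B, hx]
  have hall := hG.eventually_analyticAt.and (hAev.and (hLb.and (hrad'.and hobs)))
  obtain ⟨ρ, hρ, hall⟩ := Metric.eventually_nhds_iff.1 hall
  -- the derivative of `B`
  let B' : E → E →L[ℝ] E →L[ℝ] W := fun x ↦
    fderiv ℝ (fderiv ℝ G) x - (L x) ∘L ((ContinuousLinearMap.id ℝ E).prod (fderiv ℝ G x))
  have hB' : ∀ x, dist x x₀ < ρ → HasFDerivAt B (B' x) x := by
    intro x hx
    obtain ⟨h1, h2, -⟩ := hall hx
    refine h1.fderiv.differentiableAt.hasFDerivAt.sub ?_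
    exact HasFDerivAt.comp (g := A) x h2.differentiableAt.hasFDerivAt
      ((hasFDerivAt_id x).prodMk h1.differentiableAt.hasFDerivAt)
  -- Differentiate the radial identity `B(y)(y - x₀) = 0` in the direction `w`, then exchange `w`
  -- and `x - x₀` using the symmetry of the second derivative of `G` and the integrability
  -- condition.
  have hkey : ∀ x, dist x x₀ < ρ → ∀ w,
      B' x (x - x₀) w + B x w = L x (0, B x w) (x - x₀) := by
    intro x hx w
    obtain ⟨h1, h2, -, h4, h5⟩ := hall hx
    have hd : HasFDerivAt (fun y ↦ B y (y - x₀))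
        ((B x) ∘L (ContinuousLinearMap.id ℝ E) + (B' x).flip (x - x₀)) x :=
      (hB' x hx).clm_apply ((hasFDerivAt_id x).sub_const x₀)
    have hd0 := hd.unique ((hasFDerivAt_const (0 : W) x).congr_of_eventuallyEq h4)
    have e1 : B x w + B' x w (x - x₀) = 0 := by
      have := congrArg (fun f : E →L[ℝ] W ↦ f w) hd0
      simpa using this
    have e2 : B x (x - x₀) = 0 := h4.self_of_nhds
    have hsymm : fderiv ℝ (fderiv ℝ G) x (x - x₀) w = fderiv ℝ (fderiv ℝ G) x w (x - x₀) :=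
      (h1.contDiffAt (n := ω)).isSymmSndFDerivAt (by simp) _ _
    have e3 : ∀ u, fderiv ℝ G x u = A (x, G x) u + B x u := fun u ↦ by simp [B]
    have e4 : ∀ u, L x (u, fderiv ℝ G x u) = L x (u, A (x, G x) u) + L x (0, B x u) := by
      intro u; rw [e3, ← (L x).map_add]; simp
    have e5 : L x (x - x₀, A (x, G x) (x - x₀)) w = L x (w, A (x, G x) w) (x - x₀) := h5 _ _
    have e6 : ∀ u z, B' x u z = fderiv ℝ (fderiv ℝ G) x u z - L x (u, fderiv ℝ G x u) z :=
      fun u z ↦ rfl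
    have e7 : L x (0, (0 : W)) = 0 := (L x).map_zero
    rw [e6, e4] at e1 ⊢
    rw [e2, e7, add_zero, e5, hsymm]
    rw [add_apply] at e1
    rw [← sub_eq_zero, ← e1]
    abel
  filter_upwards [Metric.ball_mem_nhds x₀ hρ] with x hx
  set v := x - x₀ with hv
  have hmem : ∀ s ∈ Set.Icc (0 : ℝ) 1, dist (x₀ + s • v) x₀ < ρ := by
    intro s hs
    rw [dist_eq_norm, add_sub_cancel_left, norm_smul, Real.norm_of_nonneg hs.1]
    refine lt_of_le_of_lt (mul_le_of_le_one_left (norm_nonneg _) hs.2) ?_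
    rwa [hv, ← dist_eq_norm]
  -- With the factor `s`, `hkey` becomes `k' w = L(0, k w) v`, linear in `k` with bounded
  -- coefficient and `k(0) = 0`, so Grönwall applies.
  let k : ℝ → E →L[ℝ] W := fun s ↦ s • B (x₀ + s • v)
  let k' : ℝ → E →L[ℝ] W := fun s ↦ s • B' (x₀ + s • v) v + B (x₀ + s • v)
  have hk : ∀ s ∈ Set.Icc (0 : ℝ) 1, HasDerivAt k (k' s) s := by
    intro s hs
    have h1 : HasDerivAt (fun s : ℝ ↦ x₀ + s • v) v s := by
      simpa using ((hasDerivAt_id s).smul_const v).const_add x₀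
    have h2 := (hB' _ (hmem s hs)).comp_hasDerivAt s h1
    have h3 := (hasDerivAt_id s).smul h2
    simp only [id, one_smul] at h3
    exact h3
  have hbound : ∀ s ∈ Set.Ico (0 : ℝ) 1, ‖k' s‖ ≤ (‖L x₀‖ + 1) * ‖v‖ * ‖k s‖ := by
    intro s hs
    have hs' := hmem s ⟨hs.1, hs.2.le⟩
    refine ContinuousLinearMap.opNorm_le_bound _ (by positivity) fun w ↦ ?_
    have e1 : k' s w = L (x₀ + s • v) (0, k s w) v := by
      have := hkey _ hs' w
      rw [add_sub_cancel_left] at this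
      have e2 : ((0 : E), k s w) = s • ((0 : E), B (x₀ + s • v) w) := by simp [k]
      rw [e2, (L _).map_smul]
      simp only [(B' _).map_smul, (L _ _).map_smul] at this
      simpa [k'] using this
    rw [e1]
    calc ‖L (x₀ + s • v) (0, k s w) v‖ ≤ ‖L (x₀ + s • v)‖ * ‖((0 : E), k s w)‖ * ‖v‖ :=
          ContinuousLinearMap.le_of_opNorm_le _ (ContinuousLinearMap.le_opNorm _ _) _
      _ ≤ (‖L x₀‖ + 1) * (‖k s‖ * ‖w‖) * ‖v‖ := by
          gcongr
          · exact (hall hs').2.2.1.le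
          · simpa using (k s).le_opNorm w
      _ = _ := by ring
  have hzero := eq_zero_of_abs_deriv_le_mul_abs_self_of_eq_zero_right
    (fun s hs ↦ (hk s hs).continuousAt.continuousWithinAt)
    (fun s hs ↦ (hk s ⟨hs.1, hs.2.le⟩).hasDerivWithinAt) (by simp [k]) hbound 1 (by simp)
  have : B x = 0 := by simpa [k, hv] using hzero
  exact sub_eq_zero.1 this

end Frobenius

/-! ### Vanishing to infinite order -/

section Vanishing

variable {W : Type*} [NormedAddCommGroup W] [NormedSpace ℝ W]

open Asymptotics

/-- An analytic function of one variable vanishing to infinite order vanishes. -/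
lemma eventually_eq_zero_of_isBigO_pow {h : ℝ → W} (hh : AnalyticAt ℝ h 0)
    (hO : ∀ n : ℕ, h =O[𝓝 0] fun s ↦ s ^ n) : ∀ᶠ s in 𝓝 0, h s = 0 := by
  by_contra hne
  -- Otherwise `h = sⁿ g` with `g 0 ≠ 0`, whereas the bound of order `n + 1` forces `g s → 0`.
  obtain ⟨n, g, hg, hg0, heq⟩ := hh.exists_eventuallyEq_pow_smul_nonzero_iff.2 hne
  obtain ⟨C, hC⟩ := (hO (n + 1)).bound
  have h1 : ∀ᶠ s in 𝓝[≠] (0 : ℝ), ‖g s‖ ≤ C * ‖s‖ := by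
    have h2 : ∀ᶠ s in 𝓝 (0 : ℝ), s ≠ 0 → ‖g s‖ ≤ C * ‖s‖ := by
      filter_upwards [heq, hC] with s hs hs' hs0
      have hpos : 0 < ‖s‖ ^ n := by positivity
      rw [hs, sub_zero, norm_smul, norm_pow, norm_pow, pow_succ] at hs'
      refine le_of_mul_le_mul_left ?_ hpos
      linarith
    exact eventually_nhdsWithin_iff.2 h2
  have h3 : Filter.Tendsto (fun s ↦ ‖g s‖) (𝓝[≠] (0 : ℝ)) (𝓝 ‖g 0‖) :=
    hg.continuousAt.norm.tendsto.mono_left nhdsWithin_le_nhds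
  have h4 : Filter.Tendsto (fun s : ℝ ↦ C * ‖s‖) (𝓝[≠] (0 : ℝ)) (𝓝 0) := by
    have : Continuous fun s : ℝ ↦ C * ‖s‖ := by fun_prop
    simpa using (this.tendsto 0).mono_left nhdsWithin_le_nhds
  have := le_of_tendsto_of_tendsto h3 h4 h1
  exact hg0 (norm_le_zero_iff.1 this)

/-- A function vanishing at `0` whose derivative is `O(sⁿ)` is `O(sⁿ⁺¹)`. -/
lemma isBigO_pow_succ_of_deriv {h h' : ℝ → W} (hd : ∀ᶠ s in 𝓝 0, HasDerivAt h (h' s) s)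
    (h0 : h 0 = 0) {n : ℕ} (hO : h' =O[𝓝 0] fun s ↦ s ^ n) :
    h =O[𝓝 0] fun s ↦ s ^ (n + 1) := by
  obtain ⟨C, hC⟩ := hO.bound
  obtain ⟨ε, hε, hb⟩ := Metric.eventually_nhds_iff_ball.1 (hd.and hC)
  refine IsBigO.of_bound C ?_
  filter_upwards [Metric.ball_mem_nhds (0 : ℝ) hε] with s hs
  have hsub : Metric.closedBall (0 : ℝ) ‖s‖ ⊆ Metric.ball 0 ε :=
    Metric.closedBall_subset_ball (by simpa using hs)
  have hC' : 0 ≤ C * ‖s‖ ^ n := by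
    have := (norm_nonneg _).trans (hb s hs).2
    simpa using this
  have := (convex_closedBall (0 : ℝ) ‖s‖).norm_image_sub_le_of_norm_hasDerivWithin_le
    (f := h) (f' := h') (C := C * ‖s‖ ^ n)
    (fun t ht ↦ (hb t (hsub ht)).1.hasDerivWithinAt) (fun t ht ↦ ?_)
    (x := 0) (y := s) (by simp) (by simp)
  · rw [h0, sub_zero, sub_zero] at this
    rwa [norm_pow, pow_succ, ← mul_assoc]
  -- The constant of a `BigO` bound is not assumed nonnegative. Its sign is read off from the bound
  -- itself unless `s = 0` and `n > 0`, when the closed ball is a single point.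
  · have hC0 : 0 ≤ C ∨ s = 0 ∧ 0 < n := by
      rcases eq_or_ne s 0 with rfl | hs0
      · rcases Nat.eq_zero_or_pos n with rfl | hn
        · left; simpa using hC'
        · exact Or.inr ⟨rfl, hn⟩
      · left
        exact nonneg_of_mul_nonneg_left hC' (by positivity)
    have h2 := (hb t (hsub ht)).2
    rw [norm_pow] at h2
    have ht' : ‖t‖ ≤ ‖s‖ := by simpa using ht
    rcases hC0 with hC0 | ⟨rfl, hn⟩
    · exact h2.trans (by gcongr)
    · have : t = 0 := by simpa using ht'
      subst this
      exact h2

/-- A family of analytic functions `hᵣ` with `hᵣ' = bᵣ hᵣ₊₁ + Lᵣ hᵣ` for bounded linear `bᵣ` and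
continuous `Lᵣ` vanishes if all `hᵣ(0)` vanish. -/
lemma eventually_eq_zero_of_hierarchy {V : ℕ → Type*} [∀ r, NormedAddCommGroup (V r)]
    [∀ r, NormedSpace ℝ (V r)] {h : ∀ r, ℝ → V r} (hh : ∀ r, AnalyticAt ℝ (h r) 0)
    (h0 : ∀ r, h r 0 = 0) (b : ∀ r, V (r + 1) →L[ℝ] V r) (L : ∀ r, ℝ → V r →L[ℝ] V r)
    (hL : ∀ r, ContinuousAt (L r) 0)
    (hd : ∀ r, ∀ᶠ s in 𝓝 0, HasDerivAt (h r) (b r (h (r + 1) s) + L r s (h r s)) s) (r : ℕ) :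
    ∀ᶠ s in 𝓝 0, h r s = 0 := by
  refine eventually_eq_zero_of_isBigO_pow (hh r) fun n ↦ ?_
  -- Index is traded for order: the bound of order `n + 1` for `h r` uses that of order `n` for both
  -- `h r` and `h (r + 1)`.
  induction n generalizing r with
  | zero => simpa using (hh r).continuousAt.isBigO_one ℝ
  | succ n ih =>
    refine isBigO_pow_succ_of_deriv (hd r) (h0 r) (IsBigO.add ?_ ?_)
    · exact ((b r).isBigO_comp _ _).trans (ih (r + 1))
    · have h1 : (fun s ↦ ‖L r s‖ * ‖h r s‖) =O[𝓝 0] fun s : ℝ ↦ (1 : ℝ) * s ^ n :=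
        ((hL r).norm.isBigO_one ℝ).mul (ih r).norm_left
      simp only [one_mul] at h1
      refine IsBigO.trans (IsBigO.of_bound 1 (Filter.Eventually.of_forall fun s ↦ ?_)) h1
      rw [one_mul, norm_mul, norm_norm, norm_norm]
      exact (L r s).le_opNorm _

end Vanishing

/-! ### Vector-valued multilinear maps and their operations -/

section VectorTensor

/-- Continuous `k`-linear maps. This is a type synonym with only the normed structure, which keeps
type class inference on spaces of linear maps between such spaces fast. -/
def VTensor (E F : Type*) [NormedAddCommGroup E] [NormedSpace ℝ E]
    [NormedAddCommGroup F] [NormedSpace ℝ F] (k : ℕ) : Type _ := E [×k]→L[ℝ] F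

variable {E : Type*} [NormedAddCommGroup E] [NormedSpace ℝ E]
  {F : Type*} [NormedAddCommGroup F] [NormedSpace ℝ F]
  {G : Type*} [NormedAddCommGroup G] [NormedSpace ℝ G] {k : ℕ}

namespace VTensor

instance : NormedAddCommGroup (VTensor E F k) :=
  inferInstanceAs (NormedAddCommGroup (E [×k]→L[ℝ] F))

instance : NormedSpace ℝ (VTensor E F k) := inferInstanceAs (NormedSpace ℝ (E [×k]→L[ℝ] F))

instance [CompleteSpace F] : CompleteSpace (VTensor E F k) :=
  inferInstanceAs (CompleteSpace (E [×k]→L[ℝ] F))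

instance : FunLike (VTensor E F k) (Fin k → E) F := inferInstanceAs (FunLike (E [×k]→L[ℝ] F) _ _)

@[ext] lemma ext {s t : VTensor E F k} (h : ∀ v, s v = t v) : s = t := DFunLike.ext _ _ h

/-- The underlying multilinear map. -/
def toMultilinear (t : VTensor E F k) : E [×k]→L[ℝ] F := t

protected lemma add_apply (s t : VTensor E F k) (v : Fin k → E) : (s + t) v = s v + t v := rfl

protected lemma sub_apply (s t : VTensor E F k) (v : Fin k → E) : (s - t) v = s v - t v := rfl

protected lemma zero_apply (v : Fin k → E) : (0 : VTensor E F k) v = 0 := rfl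

lemma map_update_sub (t : VTensor E F k) (v : Fin k → E) (i : Fin k) (a b : E) :
    t (Function.update v i (a - b)) = t (Function.update v i a) - t (Function.update v i b) :=
  t.toMultilinear.map_update_sub v i a b

/-- The evaluation at a family of vectors, as a continuous linear map. -/
def evalCLM (F : Type*) [NormedAddCommGroup F] [NormedSpace ℝ F] (v : Fin k → E) :
    VTensor E F k →L[ℝ] F :=
  ContinuousMultilinearMap.apply ℝ (fun _ : Fin k ↦ E) F v

lemma evalCLM_apply (v : Fin k → E) (t : VTensor E F k) : evalCLM F v t = t v := rfl

/-- Composition with a linear map on the left. -/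
def postCLM (E F G : Type*) [NormedAddCommGroup E] [NormedSpace ℝ E] [NormedAddCommGroup F]
    [NormedSpace ℝ F] [NormedAddCommGroup G] [NormedSpace ℝ G] (k : ℕ) :
    (F →L[ℝ] G) →L[ℝ] VTensor E F k →L[ℝ] VTensor E G k :=
  ContinuousLinearMap.compContinuousMultilinearMapL ℝ (fun _ : Fin k ↦ E) F G

lemma postCLM_apply (S : F →L[ℝ] G) (t : VTensor E F k) (v : Fin k → E) :
    postCLM E F G k S t v = S (t v) := rfl

/-- Composition with linear maps on the right, as a multilinear operation. -/
def pullback (E F G : Type*) [NormedAddCommGroup E] [NormedSpace ℝ E] [NormedAddCommGroup F]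
    [NormedSpace ℝ F] [NormedAddCommGroup G] [NormedSpace ℝ G] (k : ℕ) :
    ContinuousMultilinearMap ℝ (fun _ : Fin k ↦ E →L[ℝ] F)
      (VTensor F G k →L[ℝ] VTensor E G k) :=
  ContinuousMultilinearMap.compContinuousLinearMapContinuousMultilinear ℝ (fun _ : Fin k ↦ E)
    (fun _ ↦ F) G

lemma pullback_apply (σ : Fin k → E →L[ℝ] F) (t : VTensor F G k) (v : Fin k → E) :
    pullback E F G k σ t v = t (fun i ↦ σ i (v i)) := rfl

/-- The action `h ↦ ∑ᵢ h(…, S vᵢ, …)` of an endomorphism on the arguments of multilinear maps. -/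
def derivationCLM (E F : Type*) [NormedAddCommGroup E] [NormedSpace ℝ E]
    [NormedAddCommGroup F] [NormedSpace ℝ F] (k : ℕ) :
    (E →L[ℝ] E) →L[ℝ] VTensor E F k →L[ℝ] VTensor E F k :=
  -- The derivation is the derivative of the pull-back at the identity, in the direction with the
  -- same endomorphism in every slot.
  ((pullback E E F k).linearDeriv fun _ ↦ ContinuousLinearMap.id ℝ E) ∘L
    (ContinuousLinearMap.pi fun _ ↦ ContinuousLinearMap.id ℝ (E →L[ℝ] E))

lemma derivationCLM_apply (S : E →L[ℝ] E) (h : VTensor E F k) (v : Fin k → E) :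
    derivationCLM E F k S h v = ∑ i, h (Function.update v i (S (v i))) := by
  rw [← evalCLM_apply]
  simp only [derivationCLM, ContinuousLinearMap.comp_apply,
    ContinuousMultilinearMap.linearDeriv_apply, sum_apply, map_sum]
  refine Finset.sum_congr rfl fun i _ ↦ ?_
  rw [evalCLM_apply, pullback_apply]
  refine congrArg h (funext fun j ↦ ?_)
  rcases eq_or_ne j i with rfl | hj <;> simp [*]

/-- Currying of the first argument, in the inverse direction. -/
def uncurryCLM (E F : Type*) [NormedAddCommGroup E] [NormedSpace ℝ E]
    [NormedAddCommGroup F] [NormedSpace ℝ F] (k : ℕ) :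
    (E →L[ℝ] VTensor E F k) →L[ℝ] VTensor E F (k + 1) :=
  (continuousMultilinearCurryLeftEquiv ℝ
    (fun _ : Fin (k + 1) ↦ E) F).symm.toContinuousLinearEquiv.toContinuousLinearMap

lemma uncurryCLM_apply (t : E →L[ℝ] VTensor E F k) (v : Fin (k + 1) → E) :
    uncurryCLM E F k t v = t (v 0) (fun i ↦ v i.succ) := rfl

/-- Insertion of a vector as the first argument. -/
def insertCLM (F : Type*) [NormedAddCommGroup F] [NormedSpace ℝ F] (k : ℕ) (a : E) :
    VTensor E F (k + 1) →L[ℝ] VTensor E F k :=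
  (ContinuousLinearMap.apply ℝ (E [×k]→L[ℝ] F) a) ∘L
    (continuousMultilinearCurryLeftEquiv ℝ
      (fun _ : Fin (k + 1) ↦ E) F).toContinuousLinearEquiv.toContinuousLinearMap

lemma insertCLM_apply (a : E) (t : VTensor E F (k + 1)) (v : Fin k → E) :
    insertCLM F k a t v = t (Fin.cons a v) := rfl

/-- Scalars (vectors of the target) as tensors without arguments. -/
def constCLM (E F : Type*) [NormedAddCommGroup E] [NormedSpace ℝ E]
    [NormedAddCommGroup F] [NormedSpace ℝ F] : F →L[ℝ] VTensor E F 0 :=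
  (continuousMultilinearCurryFin0 ℝ E F).symm.toContinuousLinearEquiv.toContinuousLinearMap

lemma constCLM_apply (z : F) (v : Fin 0 → E) : constCLM E F z v = z := rfl

lemma hasFDerivAt_eval {X : Type*} [NormedAddCommGroup X] [NormedSpace ℝ X]
    {t : X → VTensor E F k} {t' : X →L[ℝ] VTensor E F k} {g : Fin k → X → E}
    {g' : Fin k → X →L[ℝ] E} {x : X} (ht : HasFDerivAt t t' x)
    (hg : ∀ i, HasFDerivAt (g i) (g' i) x) :
    HasFDerivAt (fun x ↦ t x (g · x)) (evalCLM F (g · x) ∘L t' +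
        ∑ i, ((t x).toMultilinear.toContinuousLinearMap (g · x) i) ∘L g' i) x :=
  HasFDerivAt.continuousMultilinearMap_apply ht hg

lemma hasDerivAt_pullback {t : ℝ → VTensor F G k} {t' : VTensor F G k} {σ : ℝ → E →L[ℝ] F}
    {σ' : E →L[ℝ] F} {s : ℝ} (ht : HasDerivAt t t' s) (hσ : HasDerivAt σ σ' s) :
    HasDerivAt (fun s ↦ pullback E F G k (fun _ ↦ σ s) (t s))
      (pullback E F G k (fun _ ↦ σ s) t' +
        ∑ i, pullback E F G k (Function.update (fun _ ↦ σ s) i σ') (t s)) s := by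
  have h1 : HasDerivAt (fun s (_ : Fin k) ↦ σ s) (fun _ ↦ σ') s := hasDerivAt_pi.2 fun _ ↦ hσ
  have h2 := ((pullback E F G k).hasFDerivAt (fun _ ↦ σ s)).comp_hasDerivAt s h1
  rw [ContinuousMultilinearMap.linearDeriv_apply] at h2
  refine (h2.clm_apply ht).congr_deriv ?_
  rw [add_comm, sum_apply]
  rfl

end VTensor

end VectorTensor

/-- Composition of an analytic function with a continuous linear map. -/
lemma analyticAt_continuousLinearMap_comp {V W X : Type*} [NormedAddCommGroup V] [NormedSpace ℝ V]
    [NormedAddCommGroup W] [NormedSpace ℝ W] [NormedAddCommGroup X] [NormedSpace ℝ X]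
    (L : V →L[ℝ] W) {t : X → V} {x : X} (ht : AnalyticAt ℝ t x) :
    AnalyticAt ℝ (fun x ↦ L (t x)) x :=
  (ContinuousLinearMap.analyticAt L _).comp ht

/-! ### Covariant derivatives and the relation defect in coordinates -/

section CoordinateTensors

variable {E : Type*} [NormedAddCommGroup E] [NormedSpace ℝ E]
  {F : Type*} [NormedAddCommGroup F] [NormedSpace ℝ F] {k : ℕ}

open VTensor

/-- The action of an endomorphism on vector valued multilinear maps as a derivation. -/
def tensorActionCLM (E : Type*) [NormedAddCommGroup E] [NormedSpace ℝ E] (k : ℕ) :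
    (E →L[ℝ] E) →L[ℝ] VTensor E E k →L[ℝ] VTensor E E k :=
  postCLM E E E k - derivationCLM E E k

lemma tensorActionCLM_apply (S : E →L[ℝ] E) (h : VTensor E E k) (v : Fin k → E) :
    tensorActionCLM E k S h v = S (h v) - ∑ i, h (Function.update v i (S (v i))) := by
  rw [← derivationCLM_apply]; rfl

/-- The covariant derivative of a tensor field in coordinates; `Γ x v w` are the Christoffel
symbols, `v` being the direction of differentiation. -/
def nablaCoord (Γ : E → E →L[ℝ] E →L[ℝ] E) (t : E → VTensor E E k) (x : E) :
    VTensor E E (k + 1) :=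
  uncurryCLM E E k (fderiv ℝ t x + (tensorActionCLM E k).flip (t x) ∘L Γ x)

lemma nablaCoord_apply (Γ : E → E →L[ℝ] E →L[ℝ] E) (t : E → VTensor E E k) (x : E)
    (v : Fin (k + 1) → E) :
    nablaCoord Γ t x v = fderiv ℝ t x (v 0) (fun i ↦ v i.succ)
      + (Γ x (v 0) (t x fun i ↦ v i.succ)
        - ∑ i : Fin k, t x (Function.update (fun j ↦ v j.succ) i (Γ x (v 0) (v i.succ)))) := by
  rw [nablaCoord, uncurryCLM_apply, add_apply, VTensor.add_apply]
  exact congrArg _ (tensorActionCLM_apply _ _ _)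

/-- Iterated covariant derivative in coordinates. -/
def iterNablaCoord (Γ : E → E →L[ℝ] E →L[ℝ] E) (t : E → VTensor E E k) :
    (r : ℕ) → E → VTensor E E (k + r)
  | 0 => t
  | r + 1 => nablaCoord Γ (iterNablaCoord Γ t r)

lemma analyticAt_nablaCoord [CompleteSpace E] {Γ : E → E →L[ℝ] E →L[ℝ] E}
    {t : E → VTensor E E k} {x : E} (hΓ : AnalyticAt ℝ Γ x) (ht : AnalyticAt ℝ t x) :
    AnalyticAt ℝ (nablaCoord Γ t) x := by
  have h1 : AnalyticAt ℝ (fun x ↦ (tensorActionCLM E k).flip (t x)) x :=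
    analyticAt_continuousLinearMap_comp (W := (E →L[ℝ] E) →L[ℝ] VTensor E E k) _ ht
  have h2 : AnalyticAt ℝ (fun x ↦ (tensorActionCLM E k).flip (t x) ∘L Γ x) x :=
    (ContDiffAt.clm_comp (n := ω) h1.contDiffAt hΓ.contDiffAt).analyticAt
  exact analyticAt_continuousLinearMap_comp (uncurryCLM E E k) (ht.fderiv.add h2)

lemma analyticAt_iterNablaCoord [CompleteSpace E] {Γ : E → E →L[ℝ] E →L[ℝ] E}
    {t : E → VTensor E E k} {x : E} (hΓ : AnalyticAt ℝ Γ x) (ht : AnalyticAt ℝ t x) (r : ℕ) :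
    AnalyticAt ℝ (iterNablaCoord Γ t r) x := by
  induction r with
  | zero => exact ht
  | succ r ih => exact analyticAt_nablaCoord hΓ ih

/-- The failure of a linear map to relate two tensors. -/
def relationDefect (σ : E →L[ℝ] F) (t : VTensor E E k) (t' : VTensor F F k) : VTensor E F k :=
  postCLM E E F k σ t - pullback E F F k (fun _ ↦ σ) t'

lemma relationDefect_apply (σ : E →L[ℝ] F) (t : VTensor E E k) (t' : VTensor F F k)
    (v : Fin k → E) : relationDefect σ t t' v = σ (t v) - t' (fun i ↦ σ (v i)) := rfl

lemma analyticAt_relationDefect {X : Type*} [NormedAddCommGroup X] [NormedSpace ℝ X]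
    [CompleteSpace E] [CompleteSpace F] {σ : X → E →L[ℝ] F}
    {t : X → VTensor E E k} {t' : X → VTensor F F k} {x : X}
    (hσ : AnalyticAt ℝ σ x) (ht : AnalyticAt ℝ t x) (ht' : AnalyticAt ℝ t' x) :
    AnalyticAt ℝ (fun x ↦ relationDefect (σ x) (t x) (t' x)) x := by
  have h0 : AnalyticAt ℝ (fun x ↦ postCLM E E F k (σ x)) x :=
    ((postCLM E E F k).analyticAt _).comp hσ
  have h1 : AnalyticAt ℝ (fun x ↦ postCLM E E F k (σ x) (t x)) x :=
    (ContDiffAt.clm_apply (n := ω) h0.contDiffAt ht.contDiffAt).analyticAt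
  have h2 : ContDiffAt ℝ ω (fun x ↦ pullback E F F k (fun _ ↦ σ x)) x :=
    (pullback E F F k).contDiff.contDiffAt.comp x
      (contDiffAt_pi.2 fun _ ↦ hσ.contDiffAt)
  have h3 : AnalyticAt ℝ (fun x ↦ pullback E F F k (fun _ ↦ σ x) (t' x)) x :=
    (ContDiffAt.clm_apply (n := ω) h2 ht'.contDiffAt).analyticAt
  exact h1.sub h3

/-- The zeroth order term in the derivative of the relation defect. -/
def transportCLM (E F : Type*) [NormedAddCommGroup E] [NormedSpace ℝ E] [NormedAddCommGroup F]
    [NormedSpace ℝ F] (k : ℕ) (S : E →L[ℝ] E) (S' : F →L[ℝ] F) :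
    VTensor E F k →L[ℝ] VTensor E F k :=
  derivationCLM E F k S - postCLM E F F k S'

lemma transportCLM_apply (S : E →L[ℝ] E) (S' : F →L[ℝ] F) (h : VTensor E F k) (v : Fin k → E) :
    transportCLM E F k S S' h v = ∑ i, h (Function.update v i (S (v i))) - S' (h v) := by
  rw [← derivationCLM_apply]; rfl

/-- Along a curve to which `σ` is transported parallelly, the derivative of the relation defect of
two tensor fields is the relation defect of their covariant derivatives, up to a linear term. -/
lemma hasDerivAt_relationDefect {Γ : E → E →L[ℝ] E →L[ℝ] E} {Γ' : F → F →L[ℝ] F →L[ℝ] F}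
    {t : E → VTensor E E k} {t' : F → VTensor F F k} {x : ℝ → E} {y : ℝ → F} {σ : ℝ → E →L[ℝ] F}
    {a : E} {s : ℝ} (ht : DifferentiableAt ℝ t (x s)) (ht' : DifferentiableAt ℝ t' (y s))
    (hx : HasDerivAt x a s) (hy : HasDerivAt y (σ s a) s)
    (hσ : HasDerivAt σ (σ s ∘L Γ (x s) a - Γ' (y s) (σ s a) ∘L σ s) s) :
    HasDerivAt (fun s ↦ relationDefect (σ s) (t (x s)) (t' (y s)))
      (insertCLM F k a (relationDefect (σ s) (nablaCoord Γ t (x s)) (nablaCoord Γ' t' (y s)))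
        + transportCLM E F k (Γ (x s) a) (Γ' (y s) (σ s a))
            (relationDefect (σ s) (t (x s)) (t' (y s)))) s := by
  have h1 : HasDerivAt (fun s ↦ t (x s)) (fderiv ℝ t (x s) a) s :=
    ht.hasFDerivAt.comp_hasDerivAt s hx
  have h2 : HasDerivAt (fun s ↦ t' (y s)) (fderiv ℝ t' (y s) (σ s a)) s :=
    ht'.hasFDerivAt.comp_hasDerivAt s hy
  have h3 := ((postCLM E E F k).hasFDerivAt.comp_hasDerivAt s hσ).clm_apply h1
  refine (h3.sub (hasDerivAt_pullback h2 hσ)).congr_deriv ?_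
  ext v
  -- With `∇ = d + Γ`-terms, the sums containing `S'` in the arguments of `t'` cancel, as do the
  -- terms `σ (S (t v))`. What is left over is the action of `S` and `S'` on the defect itself.
  set S := Γ (x s) a
  set S' := Γ' (y s) (σ s a)
  have e1 : ∀ i : Fin k, (fun j ↦ (Function.update (fun _ ↦ σ s) i (σ s ∘L S - S' ∘L σ s) :
      Fin k → E →L[ℝ] F) j (v j))
      = Function.update (fun j ↦ σ s (v j)) i (σ s (S (v i)) - S' (σ s (v i))) := by
    intro i; ext j; rcases eq_or_ne j i with rfl | hj <;> simp [*]
  have e2 : ∀ i, (fun j ↦ σ s (Function.update v i (S (v i)) j))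
      = Function.update (fun j ↦ σ s (v j)) i (σ s (S (v i))) := by
    intro i; ext j; rcases eq_or_ne j i with rfl | hj <;> simp [*]
  have e3 : (∑ i, pullback E F F k (Function.update (fun _ ↦ σ s) i (σ s ∘L S - S' ∘L σ s))
        (t' (y s))) v = ∑ i, t' (y s) (Function.update (fun j ↦ σ s (v j)) i (σ s (S (v i))))
          - ∑ i, t' (y s) (Function.update (fun j ↦ σ s (v j)) i (S' (σ s (v i)))) := by
    rw [← evalCLM_apply, map_sum, ← Finset.sum_sub_distrib]
    refine Finset.sum_congr rfl fun i _ ↦ ?_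
    rw [evalCLM_apply, pullback_apply, e1, map_update_sub]
  simp only [VTensor.sub_apply, VTensor.add_apply, e3, postCLM_apply, pullback_apply,
    insertCLM_apply, transportCLM_apply, relationDefect_apply, nablaCoord_apply, Fin.cons_zero,
    Fin.cons_succ, e2, sub_apply, ContinuousLinearMap.comp_apply, map_add, map_sub, map_sum,
    Finset.sum_sub_distrib, Function.comp_apply, S, S']
  abel

end CoordinateTensors

/-! ### Analyticity tested on vectors -/

section Evaluation

open VTensor

variable {E F X : Type*} [NormedAddCommGroup E] [NormedSpace ℝ E] [FiniteDimensional ℝ E]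
  [NormedAddCommGroup F] [NormedSpace ℝ F] [NormedAddCommGroup X] [NormedSpace ℝ X]

/-- A family of linear maps on a finite-dimensional space is analytic if its evaluations are. -/
lemma analyticAt_clm_of_apply [CompleteSpace F] {f : X → E →L[ℝ] F} {x : X}
    (h : ∀ v, AnalyticAt ℝ (fun x ↦ f x v) x) : AnalyticAt ℝ f x := by
  let d := Module.finrank ℝ E
  have hd : d = Module.finrank ℝ (Fin d → ℝ) := (Module.finrank_fin_fun ℝ).symm
  let e₁ := ContinuousLinearEquiv.ofFinrankEq hd
  let e₂ := (e₁.arrowCongr (1 : F ≃L[ℝ] F)).trans (ContinuousLinearEquiv.piRing (Fin d))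
  have h1 : ContDiffAt ℝ ω (e₂.symm ∘ e₂ ∘ f) x :=
    e₂.symm.contDiff.contDiffAt.comp x (contDiffAt_pi.2 fun i ↦ (h _).contDiffAt)
  rw [← Function.comp_assoc, e₂.symm_comp_self, Function.id_comp] at h1
  exact h1.analyticAt

/-- A family of multilinear maps on a finite-dimensional space is analytic if its evaluations
are. -/
lemma analyticAt_vtensor_of_apply [CompleteSpace F] {k : ℕ} {t : X → VTensor E F k} {x : X}
    (h : ∀ v, AnalyticAt ℝ (fun x ↦ t x v) x) : AnalyticAt ℝ t x := by
  induction k with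
  | zero =>
    have h1 := analyticAt_continuousLinearMap_comp (constCLM E F) (h ![])
    refine h1.congr (Filter.Eventually.of_forall fun y ↦ ?_)
    ext v
    rw [constCLM_apply]
    exact congrArg _ (Subsingleton.elim _ _)
  | succ k ih =>
    let e := (continuousMultilinearCurryLeftEquiv ℝ (fun _ : Fin (k + 1) ↦ E) F)
    let c : X → E →L[ℝ] VTensor E F k := fun y ↦ e (t y)
    have hc : AnalyticAt ℝ c x := by
      refine analyticAt_clm_of_apply fun a ↦ ih fun v ↦ ?_
      exact h (Fin.cons a v)
    refine (analyticAt_continuousLinearMap_comp (uncurryCLM E F k) hc).congr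
      (Filter.Eventually.of_forall fun y ↦ ?_)
    exact e.symm_apply_apply (t y)

lemma _root_.AnalyticAt.clm_apply_const {E F X : Type*} [NormedAddCommGroup E] [NormedSpace ℝ E]
    [NormedAddCommGroup F] [NormedSpace ℝ F] [NormedAddCommGroup X] [NormedSpace ℝ X]
    {f : X → E →L[ℝ] F} {x : X} (h : AnalyticAt ℝ f x) (v : E) :
    AnalyticAt ℝ (fun x ↦ f x v) x :=
  analyticAt_continuousLinearMap_comp (ContinuousLinearMap.apply ℝ F v) h

lemma _root_.AnalyticAt.clm_apply_fun {E F X : Type*} [NormedAddCommGroup E] [NormedSpace ℝ E]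
    [NormedAddCommGroup F] [NormedSpace ℝ F] [NormedAddCommGroup X] [NormedSpace ℝ X]
    [CompleteSpace E] [CompleteSpace F]
    {f : X → E →L[ℝ] F} {g : X → E} {x : X} (h : AnalyticAt ℝ f x) (hg : AnalyticAt ℝ g x) :
    AnalyticAt ℝ (fun x ↦ f x (g x)) x :=
  (ContDiffAt.clm_apply (n := ω) h.contDiffAt hg.contDiffAt).analyticAt

end Evaluation

/-! ### Torsion and curvature in coordinates -/

section Curvature

variable {E : Type*} [NormedAddCommGroup E] [NormedSpace ℝ E]

open VTensor

/-- The torsion in coordinates. -/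
def torsionCoord (Γ : E → E →L[ℝ] E →L[ℝ] E) (x : E) : VTensor E E 2 :=
  uncurryCLM E E 1 ((uncurryCLM E E 0 ∘L ContinuousLinearMap.compL ℝ E E _ (constCLM E E)) ∘L
    (Γ x - (Γ x).flip))

lemma torsionCoord_apply (Γ : E → E →L[ℝ] E →L[ℝ] E) (x : E) (v : Fin 2 → E) :
    torsionCoord Γ x v = Γ x (v 0) (v 1) - Γ x (v 1) (v 0) := rfl

lemma analyticAt_torsionCoord [FiniteDimensional ℝ E] {Γ : E → E →L[ℝ] E →L[ℝ] E} {x : E}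
    (hΓ : AnalyticAt ℝ Γ x) : AnalyticAt ℝ (torsionCoord Γ) x := by
  have := FiniteDimensional.complete ℝ E
  refine analyticAt_vtensor_of_apply fun v ↦ ?_
  simp only [torsionCoord_apply]
  exact ((hΓ.clm_apply_const _).clm_apply_const _).sub
    ((hΓ.clm_apply_const _).clm_apply_const _)

/-- The operation `B(u)(w) = Γ(u) ∘ Γ(w)`. -/
def christoffelSquare (Γ : E →L[ℝ] E →L[ℝ] E) : E →L[ℝ] E →L[ℝ] E →L[ℝ] E :=
  ((ContinuousLinearMap.compL ℝ E (E →L[ℝ] E) (E →L[ℝ] E)).flip Γ) ∘L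
    (ContinuousLinearMap.compL ℝ E E E) ∘L Γ

/-- Trilinear maps as tensors. -/
def trilinearTensor (B : E →L[ℝ] E →L[ℝ] E →L[ℝ] E) : VTensor E E 3 :=
  uncurryCLM E E 2 ((uncurryCLM E E 1 ∘L
    ContinuousLinearMap.compL ℝ E (E →L[ℝ] E) _
      (uncurryCLM E E 0 ∘L ContinuousLinearMap.compL ℝ E E _ (constCLM E E))) ∘L B)

/-- The curvature in coordinates. -/
def curvatureCoord (Γ : E → E →L[ℝ] E →L[ℝ] E) (x : E) : VTensor E E 3 :=
  trilinearTensor ((fderiv ℝ Γ x + christoffelSquare (Γ x))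
    - (fderiv ℝ Γ x + christoffelSquare (Γ x)).flip)

lemma curvatureCoord_apply (Γ : E → E →L[ℝ] E →L[ℝ] E) (x : E) (v : Fin 3 → E) :
    curvatureCoord Γ x v = (fderiv ℝ Γ x (v 0) (v 1) (v 2) + Γ x (v 0) (Γ x (v 1) (v 2)))
      - (fderiv ℝ Γ x (v 1) (v 0) (v 2) + Γ x (v 1) (Γ x (v 0) (v 2))) := rfl

set_option synthInstance.maxHeartbeats 200000 in
lemma analyticAt_curvatureCoord [FiniteDimensional ℝ E] {Γ : E → E →L[ℝ] E →L[ℝ] E} {x : E}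
    (hΓ : AnalyticAt ℝ Γ x) : AnalyticAt ℝ (curvatureCoord Γ) x := by
  have := FiniteDimensional.complete ℝ E
  refine analyticAt_vtensor_of_apply fun v ↦ ?_
  simp only [curvatureCoord_apply]
  have h1 : ∀ u w z : E, AnalyticAt ℝ (fun x ↦ fderiv ℝ Γ x u w z + Γ x u (Γ x w z)) x :=
    fun u w z ↦ (((AnalyticAt.clm_apply_const (F := E →L[ℝ] E →L[ℝ] E) hΓ.fderiv
      u).clm_apply_const w).clm_apply_const z).add
      ((hΓ.clm_apply_const u).clm_apply_fun ((hΓ.clm_apply_const w).clm_apply_const z))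
  exact (h1 _ _ _).sub (h1 _ _ _)

end Curvature

lemma hasDerivAt_family_apply {V W X : Type*} [NormedAddCommGroup V] [NormedSpace ℝ V]
    [NormedAddCommGroup W] [NormedSpace ℝ W] [NormedAddCommGroup X] [NormedSpace ℝ X]
    {Φ : V → W →L[ℝ] X} {x : ℝ → V} {w : ℝ → W} {x' : V} {w' : W} {s : ℝ}
    (hΦ : DifferentiableAt ℝ Φ (x s)) (hx : HasDerivAt x x' s) (hw : HasDerivAt w w' s) :
    HasDerivAt (fun s ↦ Φ (x s) (w s)) (fderiv ℝ Φ (x s) x' (w s) + Φ (x s) w') s :=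
  (hΦ.hasFDerivAt.comp_hasDerivAt s hx).clm_apply hw

lemma hasDerivAt_line {V : Type*} [NormedAddCommGroup V] [NormedSpace ℝ V] (p d : V) (s : ℝ) :
    HasDerivAt (fun s : ℝ ↦ p + s • d) d s := by
  simpa using ((hasDerivAt_id s).smul_const d).const_add p

/-! ### The differential system of affine maps and its integrability -/

section TransportSystem

variable {E : Type*} [NormedAddCommGroup E] [NormedSpace ℝ E]
  {F : Type*} [NormedAddCommGroup F] [NormedSpace ℝ F]

/-- The total differential equation for a map together with its differential, which expresses that
the map is affine: at `(x, (y, σ))` the differential is `v ↦ (σ v, σ ∘ Γ v - Γ' (σ v) ∘ σ)`. -/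
def affineSystem (Γ : E → E →L[ℝ] E →L[ℝ] E) (Γ' : F → F →L[ℝ] F →L[ℝ] F)
    (q : E × (F × (E →L[ℝ] F))) : E →L[ℝ] F × (E →L[ℝ] F) :=
  q.2.2.prod ((ContinuousLinearMap.compL ℝ E E F q.2.2) ∘L Γ q.1
    - (ContinuousLinearMap.compL ℝ E F F).flip q.2.2 ∘L Γ' q.2.1 ∘L q.2.2)

lemma affineSystem_apply (Γ : E → E →L[ℝ] E →L[ℝ] E) (Γ' : F → F →L[ℝ] F →L[ℝ] F)
    (q : E × (F × (E →L[ℝ] F))) (v : E) :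
    affineSystem Γ Γ' q v = (q.2.2 v, q.2.2 ∘L Γ q.1 v - Γ' q.2.1 (q.2.2 v) ∘L q.2.2) := rfl

lemma _root_.AnalyticAt.clm_comp_clm {X E F G : Type*} [NormedAddCommGroup X] [NormedSpace ℝ X]
    [NormedAddCommGroup E] [NormedSpace ℝ E] [NormedAddCommGroup F] [NormedSpace ℝ F]
    [NormedAddCommGroup G] [NormedSpace ℝ G] [CompleteSpace F] [CompleteSpace G]
    {f : X → F →L[ℝ] G} {g : X → E →L[ℝ] F} {x : X} (hf : AnalyticAt ℝ f x)
    (hg : AnalyticAt ℝ g x) : AnalyticAt ℝ (fun x ↦ f x ∘L g x) x :=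
  (ContDiffAt.clm_comp (n := ω) hf.contDiffAt hg.contDiffAt).analyticAt

lemma analyticAt_affineSystem [FiniteDimensional ℝ E] [FiniteDimensional ℝ F]
    {Γ : E → E →L[ℝ] E →L[ℝ] E} {Γ' : F → F →L[ℝ] F →L[ℝ] F} {q : E × (F × (E →L[ℝ] F))}
    (hΓ : AnalyticAt ℝ Γ q.1) (hΓ' : AnalyticAt ℝ Γ' q.2.1) :
    AnalyticAt ℝ (affineSystem Γ Γ') q := by
  have := FiniteDimensional.complete ℝ E
  have := FiniteDimensional.complete ℝ F
  refine analyticAt_clm_of_apply fun v ↦ ?_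
  simp only [affineSystem_apply]
  have hσ : AnalyticAt ℝ (fun q : E × (F × (E →L[ℝ] F)) ↦ q.2.2) q :=
    analyticAt_snd.comp analyticAt_snd
  have hy : AnalyticAt ℝ (fun q : E × (F × (E →L[ℝ] F)) ↦ q.2.1) q :=
    analyticAt_fst.comp analyticAt_snd
  have h1 : AnalyticAt ℝ (fun q : E × (F × (E →L[ℝ] F)) ↦ Γ q.1) q :=
    AnalyticAt.comp (g := Γ) hΓ analyticAt_fst
  have h2 : AnalyticAt ℝ (fun q : E × (F × (E →L[ℝ] F)) ↦ Γ' q.2.1) q :=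
    AnalyticAt.comp (g := Γ') hΓ' hy
  exact (hσ.clm_apply_const v).prod ((hσ.clm_comp_clm (h1.clm_apply_const v)).sub
    ((h2.clm_apply_fun (hσ.clm_apply_const v)).clm_comp_clm hσ))

/-- The integrability condition of the system for affine maps holds where torsion and curvature are
related. -/
lemma fderiv_affineSystem_symm {Γ : E → E →L[ℝ] E →L[ℝ] E} {Γ' : F → F →L[ℝ] F →L[ℝ] F} {x : E}
    {y : F} {σ : E →L[ℝ] F} (hA : DifferentiableAt ℝ (affineSystem Γ Γ') (x, (y, σ)))
    (hΓ : DifferentiableAt ℝ Γ x) (hΓ' : DifferentiableAt ℝ Γ' y)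
    (hT : relationDefect σ (torsionCoord Γ x) (torsionCoord Γ' y) = 0)
    (hR : relationDefect σ (curvatureCoord Γ x) (curvatureCoord Γ' y) = 0) (u w : E) :
    fderiv ℝ (affineSystem Γ Γ') (x, (y, σ)) (u, affineSystem Γ Γ' (x, (y, σ)) u) w
      = fderiv ℝ (affineSystem Γ Γ') (x, (y, σ)) (w, affineSystem Γ Γ' (x, (y, σ)) w) u := by
  have hT' : ∀ a b : E, σ (Γ x a b) - σ (Γ x b a)
      = Γ' y (σ a) (σ b) - Γ' y (σ b) (σ a) := by
    intro a b
    have h := congrArg (fun t : VTensor E F 2 ↦ t ![a, b]) hT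
    simp only [relationDefect_apply, torsionCoord_apply, VTensor.zero_apply] at h
    simpa [sub_eq_zero] using h
  have hR' : ∀ a b c : E, σ (fderiv ℝ Γ x a b c + Γ x a (Γ x b c))
        - σ (fderiv ℝ Γ x b a c + Γ x b (Γ x a c))
      = (fderiv ℝ Γ' y (σ a) (σ b) (σ c) + Γ' y (σ a) (Γ' y (σ b) (σ c)))
        - (fderiv ℝ Γ' y (σ b) (σ a) (σ c) + Γ' y (σ b) (Γ' y (σ a) (σ c))) := by
    intro a b c
    have h := congrArg (fun t : VTensor E F 3 ↦ t ![a, b, c]) hR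
    simp only [relationDefect_apply, curvatureCoord_apply, VTensor.zero_apply, map_sub] at h
    exact sub_eq_zero.1 h
  -- `δ a` is the prescribed derivative of `σ` in the direction `a`; its symmetry `δ u w = δ w u` is
  -- precisely the torsion relation.
  let δ : E → E →L[ℝ] F := fun a ↦ σ ∘L Γ x a - Γ' y (σ a) ∘L σ
  have hδ : ∀ a b, δ a b = σ (Γ x a b) - Γ' y (σ a) (σ b) := fun a b ↦ rfl
  have hδs : δ u w = δ w u := by
    have := hT' u w
    rw [sub_eq_sub_iff_add_eq_add] at this
    rw [hδ, hδ, sub_eq_sub_iff_add_eq_add, this, add_comm]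
  -- The derivative is found by differentiating along the line through `(x, (y, σ))` with direction
  -- `(a, (σ a, δ a))`. After antisymmetrisation the mixed products of `Γ` and `Γ'` cancel, and the
  -- second component is the curvature relation.
  have key : ∀ a b : E,
      fderiv ℝ (affineSystem Γ Γ') (x, (y, σ)) (a, affineSystem Γ Γ' (x, (y, σ)) a) b
        = (δ a b, (δ a ∘L Γ x b + σ ∘L fderiv ℝ Γ x a b)
          - ((fderiv ℝ Γ' y (σ a) (σ b) + Γ' y (δ a b)) ∘L σ + Γ' y (σ b) ∘L δ a)) := by
    intro a b
    have hx := hasDerivAt_line x a 0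
    have hy := hasDerivAt_line y (σ a) 0
    have hσ := hasDerivAt_line σ (δ a) 0
    have hb := hasDerivAt_const (0 : ℝ) b
    have hΓx := hasDerivAt_family_apply (Φ := Γ) (by simpa using hΓ) hx hb
    have hσb := hσ.clm_apply hb
    have hΓy := hasDerivAt_family_apply (Φ := Γ') (by simpa using hΓ') hy hσb
    have h2 := hσb.prodMk ((hσ.clm_comp hΓx).sub (hΓy.clm_comp hσ))
    have h1 := hasDerivAt_family_apply (Φ := affineSystem Γ Γ')
      (by simpa using hA) (hx.prodMk (hy.prodMk hσ)) hb
    have h3 := h1.unique h2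
    simp only [zero_smul, add_zero, map_zero] at h3
    exact h3
  rw [key, key]
  refine Prod.ext hδs ?_
  dsimp only
  rw [hδs]
  ext z
  have h := hR' u w z
  simp only [_root_.add_apply, _root_.sub_apply, ContinuousLinearMap.comp_apply, hδ, map_sub,
    map_add] at h ⊢
  rw [← sub_eq_zero] at h ⊢
  rw [← h]
  abel

end TransportSystem

/-! ### From radial identities to identities along lines -/

section Defect

variable {E : Type*} [NormedAddCommGroup E] [NormedSpace ℝ E]
  {W : Type*} [NormedAddCommGroup W] [NormedSpace ℝ W]

/-- At `x₀ + s • v` the radial vector is `s • v`, so one divides by `s` when `s ≠ 0`; continuity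
supplies `s = 0`, where the radial identity is empty. -/
lemma eventually_apply_eq_of_radial {P Q : E → E →L[ℝ] W} {x₀ : E} (hP : ContinuousAt P x₀)
    (hQ : ContinuousAt Q x₀) (h : ∀ᶠ x in 𝓝 x₀, P x (x - x₀) = Q x (x - x₀)) (v : E) :
    ∀ᶠ s in 𝓝 (0 : ℝ), P (x₀ + s • v) v = Q (x₀ + s • v) v := by
  have hc : ContinuousAt (fun s : ℝ ↦ x₀ + s • v) 0 := by fun_prop
  have hc' : Filter.Tendsto (fun s : ℝ ↦ x₀ + s • v) (𝓝 0) (𝓝 x₀) := by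
    simpa using hc.tendsto
  have h1 : ∀ {R : E → E →L[ℝ] W}, ContinuousAt R x₀ →
      ContinuousAt (fun s : ℝ ↦ R (x₀ + s • v) v) 0 := by
    intro R hR
    refine ContinuousAt.clm_apply (ContinuousAt.comp (g := R) ?_ hc) continuousAt_const
    simpa using hR
  have h2 : ∀ᶠ s in 𝓝[≠] (0 : ℝ), P (x₀ + s • v) v = Q (x₀ + s • v) v := by
    rw [eventually_nhdsWithin_iff]
    filter_upwards [hc'.eventually h] with s hs hs0
    rw [add_sub_cancel_left, map_smul, map_smul] at hs
    exact smul_right_injective W hs0 hs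
  have h3 : P (x₀ + (0 : ℝ) • v) v = Q (x₀ + (0 : ℝ) • v) v :=
    tendsto_nhds_unique (((h1 hP).tendsto.mono_left nhdsWithin_le_nhds).congr' h2)
      ((h1 hQ).tendsto.mono_left nhdsWithin_le_nhds)
  filter_upwards [eventually_nhdsWithin_iff.1 h2] with s hs
  rcases eq_or_ne s 0 with rfl | hs0
  · exact h3
  · exact hs hs0

end Defect

open VTensor

/-! ### Existence of affine maps in coordinates -/

section CoordinateTheorem

variable {E : Type*} [NormedAddCommGroup E] [NormedSpace ℝ E] [FiniteDimensional ℝ E]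
  {F : Type*} [NormedAddCommGroup F] [NormedSpace ℝ F] [FiniteDimensional ℝ F]
  {Γ : E → E →L[ℝ] E →L[ℝ] E} {Γ' : F → F →L[ℝ] F →L[ℝ] F}

/-- The defects of all iterated covariant derivatives along the ray form the hierarchy of
`eventually_eq_zero_of_hierarchy`; `hyv` and `hσv` say that `y` moves with velocity `σ v` and that
`σ` is parallel. -/
lemma eventually_relationDefect_line_eq_zero {k : ℕ} {t : E → VTensor E E k}
    {t' : F → VTensor F F k} {x₀ : E} {y : E → F} {σ : E → E →L[ℝ] F}
    (hΓ : AnalyticAt ℝ Γ x₀) (hΓ' : AnalyticAt ℝ Γ' (y x₀)) (ht : AnalyticAt ℝ t x₀)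
    (ht' : AnalyticAt ℝ t' (y x₀)) (hy : AnalyticAt ℝ y x₀) (hσ : AnalyticAt ℝ σ x₀) (v : E)
    (hyv : ∀ᶠ s in 𝓝 (0 : ℝ), HasDerivAt (fun s : ℝ ↦ y (x₀ + s • v)) (σ (x₀ + s • v) v) s)
    (hσv : ∀ᶠ s in 𝓝 (0 : ℝ), HasDerivAt (fun s : ℝ ↦ σ (x₀ + s • v))
      (σ (x₀ + s • v) ∘L Γ (x₀ + s • v) v
        - Γ' (y (x₀ + s • v)) (σ (x₀ + s • v) v) ∘L σ (x₀ + s • v)) s)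
    (h0 : ∀ r, relationDefect (σ x₀) (iterNablaCoord Γ t r x₀)
      (iterNablaCoord Γ' t' r (y x₀)) = 0) :
    ∀ᶠ s in 𝓝 (0 : ℝ), relationDefect (σ (x₀ + s • v)) (t (x₀ + s • v))
      (t' (y (x₀ + s • v))) = 0 := by
  have := FiniteDimensional.complete ℝ E
  have := FiniteDimensional.complete ℝ F
  have hline : AnalyticAt ℝ (fun s : ℝ ↦ x₀ + s • v) 0 :=
    analyticAt_const.add (analyticAt_id.smul analyticAt_const)
  have hl0 : x₀ + (0 : ℝ) • v = x₀ := by simp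
  have hy1 : AnalyticAt ℝ (fun s : ℝ ↦ y (x₀ + s • v)) 0 :=
    AnalyticAt.comp (g := y) (by rwa [hl0]) hline
  have hσ1 : AnalyticAt ℝ (fun s : ℝ ↦ σ (x₀ + s • v)) 0 :=
    AnalyticAt.comp (g := σ) (by rwa [hl0]) hline
  have hT : ∀ r, AnalyticAt ℝ (iterNablaCoord Γ t r) x₀ := analyticAt_iterNablaCoord hΓ ht
  have hT' : ∀ r, AnalyticAt ℝ (iterNablaCoord Γ' t' r) (y x₀) := analyticAt_iterNablaCoord hΓ' ht'
  have hΓ1 : AnalyticAt ℝ (fun s : ℝ ↦ Γ (x₀ + s • v)) 0 :=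
    AnalyticAt.comp (g := Γ) (by rwa [hl0]) hline
  have hΓ1' : AnalyticAt ℝ (fun s : ℝ ↦ Γ' (y (x₀ + s • v))) 0 :=
    AnalyticAt.comp (g := Γ') (by rwa [hl0]) hy1
  have key := eventually_eq_zero_of_hierarchy (V := fun r ↦ VTensor E F (k + r))
    (h := fun r s ↦ relationDefect (σ (x₀ + s • v)) (iterNablaCoord Γ t r (x₀ + s • v))
      (iterNablaCoord Γ' t' r (y (x₀ + s • v)))) ?_ ?_
    (fun r ↦ insertCLM F (k + r) v)
    (fun r s ↦ transportCLM E F (k + r) (Γ (x₀ + s • v) v)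
      (Γ' (y (x₀ + s • v)) (σ (x₀ + s • v) v))) ?_ ?_ 0
  · exact key
  · intro r
    refine analyticAt_relationDefect hσ1 ?_ ?_
    · exact AnalyticAt.comp (g := iterNablaCoord Γ t r) (by rw [hl0]; exact hT r) hline
    · exact AnalyticAt.comp (g := iterNablaCoord Γ' t' r) (by rw [hl0]; exact hT' r) hy1
  · intro r
    simpa using h0 r
  · intro r
    have c1 : ContinuousAt (fun s : ℝ ↦ Γ (x₀ + s • v) v) 0 :=
      (hΓ1.clm_apply_const v).continuousAt
    have c2 : ContinuousAt (fun s : ℝ ↦ Γ' (y (x₀ + s • v)) (σ (x₀ + s • v) v)) 0 :=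
      (hΓ1'.clm_apply_fun (hσ1.clm_apply_const v)).continuousAt
    exact ((derivationCLM E F (k + r)).continuous.continuousAt.comp c1).sub
      ((postCLM E F F (k + r)).continuous.continuousAt.comp c2)
  · intro r
    have d1 : ∀ᶠ s in 𝓝 (0 : ℝ), AnalyticAt ℝ (iterNablaCoord Γ t r) (x₀ + s • v) :=
      hline.continuousAt.eventually (by dsimp only; rw [hl0]; exact (hT r).eventually_analyticAt)
    have d2 : ∀ᶠ s in 𝓝 (0 : ℝ), AnalyticAt ℝ (iterNablaCoord Γ' t' r) (y (x₀ + s • v)) :=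
      hy1.continuousAt.eventually (by dsimp only; rw [hl0]; exact (hT' r).eventually_analyticAt)
    filter_upwards [d1, d2, hyv, hσv] with s h1 h2 h3 h4
    have h5 := hasDerivAt_relationDefect (x := fun s : ℝ ↦ x₀ + s • v)
      (y := fun s : ℝ ↦ y (x₀ + s • v)) (σ := fun s : ℝ ↦ σ (x₀ + s • v))
      h1.differentiableAt h2.differentiableAt (hasDerivAt_line x₀ v s) h3 h4
    exact h5

-- The range of `s` in the hypothesis may shrink with `v`. On a fixed ball of analyticity the
-- identity theorem, applied to the segment from `x₀` to `x`, removes this dependence.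
omit [FiniteDimensional ℝ E] in
lemma eventually_eq_zero_of_forall_line {W : Type*} [NormedAddCommGroup W] [NormedSpace ℝ W]
    [CompleteSpace W] {D : E → W} {x₀ : E} (hD : AnalyticAt ℝ D x₀)
    (h : ∀ v, ∀ᶠ s in 𝓝 (0 : ℝ), D (x₀ + s • v) = 0) : ∀ᶠ x in 𝓝 x₀, D x = 0 := by
  obtain ⟨ε, hε, hball⟩ := Metric.eventually_nhds_iff_ball.1 hD.eventually_analyticAt
  refine Metric.eventually_nhds_iff_ball.2 ⟨ε, hε, fun x hx ↦ ?_⟩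
  have han : AnalyticOnNhd ℝ (fun s : ℝ ↦ D (x₀ + s • (x - x₀))) (Set.Icc 0 1) := by
    intro s hs
    have hline : AnalyticAt ℝ (fun s : ℝ ↦ x₀ + s • (x - x₀)) s :=
      analyticAt_const.add (analyticAt_id.smul analyticAt_const)
    refine AnalyticAt.comp (g := D) (hball _ ?_) hline
    rw [Metric.mem_ball, dist_eq_norm] at hx ⊢
    rw [add_sub_cancel_left, norm_smul, Real.norm_of_nonneg hs.1]
    exact lt_of_le_of_lt (mul_le_of_le_one_left (norm_nonneg _) hs.2) hx
  have := han.eqOn_zero_of_preconnected_of_eventuallyEq_zero isPreconnected_Icc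
    (Set.left_mem_Icc.2 zero_le_one) (h (x - x₀)) (Set.right_mem_Icc.2 zero_le_one)
  simpa using this

/-- Local existence of affine maps in coordinates. -/
theorem exists_affine_coord {x₀ : E} {y₀ : F} {σ₀ : E →L[ℝ] F} (hΓ : AnalyticAt ℝ Γ x₀)
    (hΓ' : AnalyticAt ℝ Γ' y₀)
    (hT : ∀ r, relationDefect σ₀ (iterNablaCoord Γ (torsionCoord Γ) r x₀)
      (iterNablaCoord Γ' (torsionCoord Γ') r y₀) = 0)
    (hR : ∀ r, relationDefect σ₀ (iterNablaCoord Γ (curvatureCoord Γ) r x₀)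
      (iterNablaCoord Γ' (curvatureCoord Γ') r y₀) = 0) :
    ∃ f : E → F, AnalyticAt ℝ f x₀ ∧ f x₀ = y₀ ∧ fderiv ℝ f x₀ = σ₀ ∧
      ∀ᶠ x in 𝓝 x₀, ∀ v w, fderiv ℝ (fderiv ℝ f) x v w
        + Γ' (f x) (fderiv ℝ f x v) (fderiv ℝ f x w) = fderiv ℝ f x (Γ x v w) := by
  have := FiniteDimensional.complete ℝ E
  have := FiniteDimensional.complete ℝ F
  have hA : AnalyticAt ℝ (affineSystem Γ Γ') (x₀, (y₀, σ₀)) := analyticAt_affineSystem hΓ hΓ'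
  obtain ⟨G, hG, hG0, hrad⟩ := exists_analyticAt_radial_solution hA
  rw [← hG0] at hA
  have hy : AnalyticAt ℝ (fun x ↦ (G x).1) x₀ := analyticAt_fst.comp hG
  have hσ : AnalyticAt ℝ (fun x ↦ (G x).2) x₀ := analyticAt_snd.comp hG
  have hgraph : AnalyticAt ℝ (fun x ↦ (x, G x)) x₀ := analyticAt_id.prod hG
  have hAG : AnalyticAt ℝ (fun x ↦ affineSystem Γ Γ' (x, G x)) x₀ :=
    AnalyticAt.comp (g := affineSystem Γ Γ') hA hgraph
  have hy0 : (G x₀).1 = y₀ := by rw [hG0]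
  have hσ0 : (G x₀).2 = σ₀ := by rw [hG0]
  have hΓ'' : AnalyticAt ℝ Γ' (G x₀).1 := by rwa [hy0]
  have hline : ∀ v, ∀ᶠ s in 𝓝 (0 : ℝ), HasDerivAt (fun s : ℝ ↦ G (x₀ + s • v))
      (affineSystem Γ Γ' (x₀ + s • v, G (x₀ + s • v)) v) s := by
    intro v
    have hc : Filter.Tendsto (fun s : ℝ ↦ x₀ + s • v) (𝓝 0) (𝓝 x₀) := by
      have : Continuous (fun s : ℝ ↦ x₀ + s • v) := by fun_prop
      simpa using this.tendsto 0
    filter_upwards [eventually_apply_eq_of_radial hG.fderiv.continuousAt hAG.continuousAt hrad v,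
      hc.eventually hG.eventually_analyticAt] with s h1 h2
    rw [← h1]
    exact h2.differentiableAt.hasFDerivAt.comp_hasDerivAt s (hasDerivAt_line x₀ v s)
  -- This uses only the equation along rays, so it is available before `G` is known to solve the
  -- full system.
  have hvan : ∀ {k : ℕ} {t : E → VTensor E E k} {t' : F → VTensor F F k}, AnalyticAt ℝ t x₀ →
      AnalyticAt ℝ t' y₀ → (∀ r, relationDefect σ₀ (iterNablaCoord Γ t r x₀)
        (iterNablaCoord Γ' t' r y₀) = 0) →
      ∀ᶠ x in 𝓝 x₀, relationDefect (G x).2 (t x) (t' (G x).1) = 0 := by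
    intro k t t' ht ht' h
    have ht'' : AnalyticAt ℝ t' (G x₀).1 := by rwa [hy0]
    refine eventually_eq_zero_of_forall_line (analyticAt_relationDefect hσ ht
      (AnalyticAt.comp (g := t') ht'' hy)) fun v ↦ ?_
    refine eventually_relationDefect_line_eq_zero (y := fun x ↦ (G x).1) (σ := fun x ↦ (G x).2)
      hΓ hΓ'' ht ht'' hy hσ v ?_ ?_ (by simpa only [hy0, hσ0] using h)
    · filter_upwards [hline v] with s hs
      exact (hasFDerivAt_fst (𝕜 := ℝ)).comp_hasDerivAt s hs
    · filter_upwards [hline v] with s hs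
      exact (hasFDerivAt_snd (𝕜 := ℝ)).comp_hasDerivAt s hs
  have htot : ∀ᶠ x in 𝓝 x₀, fderiv ℝ G x = affineSystem Γ Γ' (x, G x) := by
    refine eventually_fderiv_eq_of_radial hA hG hrad ?_
    filter_upwards [hvan (analyticAt_torsionCoord hΓ) (analyticAt_torsionCoord hΓ') hT,
      hvan (analyticAt_curvatureCoord hΓ) (analyticAt_curvatureCoord hΓ') hR,
      hgraph.continuousAt.eventually hA.eventually_analyticAt, hΓ.eventually_analyticAt,
      hy.continuousAt.eventually hΓ''.eventually_analyticAt] with x h1 h2 h3 h4 h5 u w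
    exact fderiv_affineSystem_symm h3.differentiableAt h4.differentiableAt h5.differentiableAt
      h1 h2 u w
  have hsol : ∀ᶠ x in 𝓝 x₀, HasFDerivAt G (affineSystem Γ Γ' (x, G x)) x := by
    filter_upwards [htot, hG.eventually_analyticAt] with x h1 h2
    rw [← h1]
    exact h2.differentiableAt.hasFDerivAt
  -- The first component of the system identifies `σ` with `df`; the second then becomes the
  -- second-order equation for `f`.
  have hdf : ∀ᶠ x in 𝓝 x₀, fderiv ℝ (fun x ↦ (G x).1) x = (G x).2 := by
    filter_upwards [hsol] with x hx
    rw [hx.fst.fderiv]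
    ext v
    simp [affineSystem_apply]
  refine ⟨fun x ↦ (G x).1, hy, hy0, by rw [hdf.self_of_nhds, hσ0], ?_⟩
  filter_upwards [hdf.eventually_nhds, hsol] with x h1 h2 v w
  have h3 : fderiv ℝ (fderiv ℝ fun x ↦ (G x).1) x = fderiv ℝ (fun x ↦ (G x).2) x :=
    Filter.EventuallyEq.fderiv_eq h1
  rw [h3, h1.self_of_nhds, h2.snd.fderiv]
  simp [affineSystem_apply]

end CoordinateTheorem

/-! ### Functions, vector fields and Lie brackets in a chart -/

section ChartCoordinates

variable {E : Type*} [NormedAddCommGroup E] [NormedSpace ℝ E]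
  {M : Type*} [TopologicalSpace M] [ChartedSpace E M] [IsManifold 𝓘(ℝ, E) ω M]
  {W : Type*} [NormedAddCommGroup W] [NormedSpace ℝ W]

/-- The coordinates of tangent vectors at `x` with respect to the chart at `x₀`. -/
def coordAt (x₀ x : M) : TangentSpace 𝓘(ℝ, E) x →L[ℝ] E :=
  (trivializationAt E (TangentSpace 𝓘(ℝ, E) : M → Type _) x₀).continuousLinearMapAt ℝ x

/-- The tangent vector at `x` with given coordinates with respect to the chart at `x₀`. -/
def frameAt (x₀ x : M) : E →L[ℝ] TangentSpace 𝓘(ℝ, E) x :=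
  (trivializationAt E (TangentSpace 𝓘(ℝ, E) : M → Type _) x₀).symmL ℝ x

lemma coordAt_frameAt {x₀ x : M} (hx : x ∈ (chartAt E x₀).source) (w : E) :
    coordAt x₀ x (frameAt x₀ x w) = w :=
  Trivialization.continuousLinearMapAt_symmL _ hx w

lemma frameAt_coordAt {x₀ x : M} (hx : x ∈ (chartAt E x₀).source) (v : TangentSpace 𝓘(ℝ, E) x) :
    frameAt x₀ x (coordAt x₀ x v) = v :=
  Trivialization.symmL_continuousLinearMapAt _ hx v

lemma coordAt_injective {x₀ x : M} (hx : x ∈ (chartAt E x₀).source) :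
    Function.Injective (coordAt (E := E) x₀ x) :=
  fun v w h ↦ by rw [← frameAt_coordAt hx v, h, frameAt_coordAt hx]

lemma trivializationAt_snd {x₀ x : M} (hx : x ∈ (chartAt E x₀).source)
    (v : TangentSpace 𝓘(ℝ, E) x) :
    ((trivializationAt E (TangentSpace 𝓘(ℝ, E) : M → Type _) x₀) ⟨x, v⟩).2 = coordAt x₀ x v :=
  by
  rw [coordAt, Trivialization.continuousLinearMapAt_apply,
    Trivialization.coe_linearMapAt_of_mem _ hx]

lemma coordAt_eq_mfderiv {x₀ x : M} (hx : x ∈ (chartAt E x₀).source) :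
    coordAt x₀ x = mfderiv 𝓘(ℝ, E) 𝓘(ℝ, E) (extChartAt 𝓘(ℝ, E) x₀) x :=
  TangentBundle.continuousLinearMapAt_trivializationAt hx

omit [IsManifold 𝓘(ℝ, E) ω M] in
lemma extChartAt_target_mem_nhds_image {x₀ x : M} (hx : x ∈ (chartAt E x₀).source) :
    (extChartAt 𝓘(ℝ, E) x₀).target ∈ 𝓝 (extChartAt 𝓘(ℝ, E) x₀ x) :=
  extChartAt_target_mem_nhds' ((extChartAt 𝓘(ℝ, E) x₀).map_source (by rwa [extChartAt_source]))

/-- The expression of a function in the chart at `x₀`. -/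
def readIn (x₀ : M) (g : M → W) : E → W := g ∘ (extChartAt 𝓘(ℝ, E) x₀).symm

omit [IsManifold 𝓘(ℝ, E) ω M] [NormedAddCommGroup W] [NormedSpace ℝ W] in
lemma readIn_apply {x₀ x : M} (hx : x ∈ (chartAt E x₀).source) (g : M → W) :
    readIn x₀ g (extChartAt 𝓘(ℝ, E) x₀ x) = g x := by
  rw [readIn, Function.comp_apply, (extChartAt 𝓘(ℝ, E) x₀).left_inv (by rwa [extChartAt_source])]

omit [IsManifold 𝓘(ℝ, E) ω M] [NormedAddCommGroup W] [NormedSpace ℝ W] in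
lemma eventuallyEq_readIn_comp {x₀ x : M} (hx : x ∈ (chartAt E x₀).source) (g : M → W) :
    g =ᶠ[𝓝 x] readIn x₀ g ∘ extChartAt 𝓘(ℝ, E) x₀ := by
  filter_upwards [(chartAt E x₀).open_source.mem_nhds hx] with y hy
  exact (readIn_apply hy g).symm

lemma contMDiffAt_iff_readIn {x₀ x : M} (hx : x ∈ (chartAt E x₀).source) {g : M → W} {n : ℕ∞ω} :
    ContMDiffAt 𝓘(ℝ, E) 𝓘(ℝ, W) n g x ↔
      ContDiffAt ℝ n (readIn x₀ g) (extChartAt 𝓘(ℝ, E) x₀ x) := by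
  have hn : n ≤ ω := le_top
  constructor
  · intro h
    rw [← contMDiffAt_iff_contDiffAt]
    have h1 : ContMDiffAt 𝓘(ℝ, E) 𝓘(ℝ, E) n (extChartAt 𝓘(ℝ, E) x₀).symm
        (extChartAt 𝓘(ℝ, E) x₀ x) :=
      ((contMDiffOn_extChartAt_symm (I := 𝓘(ℝ, E)) (n := ω) x₀).contMDiffAt
        (extChartAt_target_mem_nhds_image hx)).of_le hn
    exact ContMDiffAt.comp _ (by
      rw [(extChartAt 𝓘(ℝ, E) x₀).left_inv (by rwa [extChartAt_source])]; exact h) h1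
  · intro h
    have h1 : ContMDiffAt 𝓘(ℝ, E) 𝓘(ℝ, E) n (extChartAt 𝓘(ℝ, E) x₀) x :=
      (contMDiffAt_extChartAt' (n := ω) hx).of_le hn
    exact (ContMDiffAt.comp x h.contMDiffAt h1).congr_of_eventuallyEq
      (eventuallyEq_readIn_comp hx g)

lemma mdifferentiableAt_iff_readIn {x₀ x : M} (hx : x ∈ (chartAt E x₀).source) {g : M → W} :
    MDifferentiableAt 𝓘(ℝ, E) 𝓘(ℝ, W) g x ↔
      DifferentiableAt ℝ (readIn x₀ g) (extChartAt 𝓘(ℝ, E) x₀ x) := by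
  constructor
  · intro h
    rw [← mdifferentiableAt_iff_differentiableAt]
    have h1 : MDifferentiableAt 𝓘(ℝ, E) 𝓘(ℝ, E) (extChartAt 𝓘(ℝ, E) x₀).symm
        (extChartAt 𝓘(ℝ, E) x₀ x) :=
      ((contMDiffOn_extChartAt_symm (I := 𝓘(ℝ, E)) (n := 1) x₀).contMDiffAt
        (extChartAt_target_mem_nhds_image hx)).mdifferentiableAt one_ne_zero
    exact MDifferentiableAt.comp _ (by
      rw [(extChartAt 𝓘(ℝ, E) x₀).left_inv (by rwa [extChartAt_source])]; exact h) h1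
  · intro h
    have h1 : MDifferentiableAt 𝓘(ℝ, E) 𝓘(ℝ, E) (extChartAt 𝓘(ℝ, E) x₀) x :=
      mdifferentiableAt_extChartAt hx
    exact (MDifferentiableAt.comp x h.mdifferentiableAt h1).congr_of_eventuallyEq
      (eventuallyEq_readIn_comp hx g)

lemma mvfderiv_eq_fderiv_readIn {x₀ x : M} (hx : x ∈ (chartAt E x₀).source) {g : M → W}
    (hg : MDifferentiableAt 𝓘(ℝ, E) 𝓘(ℝ, W) g x) (v : TangentSpace 𝓘(ℝ, E) x) :
    mvfderiv 𝓘(ℝ, E) g x v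
      = fderiv ℝ (readIn x₀ g) (extChartAt 𝓘(ℝ, E) x₀ x) (coordAt x₀ x v) := by
  have h0 := (mdifferentiableAt_iff_readIn hx).1 hg
  have h1 : MDifferentiableAt 𝓘(ℝ, E) 𝓘(ℝ, E) (extChartAt 𝓘(ℝ, E) x₀) x :=
    mdifferentiableAt_extChartAt hx
  have h2 : mfderiv 𝓘(ℝ, E) 𝓘(ℝ, W) g x
      = mfderiv 𝓘(ℝ, E) 𝓘(ℝ, W) (readIn x₀ g ∘ extChartAt 𝓘(ℝ, E) x₀) x :=
    (eventuallyEq_readIn_comp hx g).mfderiv_eq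
  have h3 := mfderiv_comp x h0.mdifferentiableAt h1
  have h4 : mfderiv 𝓘(ℝ, E) 𝓘(ℝ, W) g x v = fderiv ℝ (readIn x₀ g) (extChartAt 𝓘(ℝ, E) x₀ x)
      (coordAt x₀ x v) := by
    rw [h2, h3, coordAt_eq_mfderiv hx, mfderiv_eq_fderiv]
    rfl
  exact h4

/-- The coordinate expression of a vector field in the chart at `x₀`. -/
def fieldCoord (x₀ : M) (X : ∀ x : M, TangentSpace 𝓘(ℝ, E) x) : E → E :=
  readIn x₀ fun x ↦ coordAt x₀ x (X x)

lemma fieldCoord_apply {x₀ x : M} (hx : x ∈ (chartAt E x₀).source)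
    (X : ∀ x : M, TangentSpace 𝓘(ℝ, E) x) :
    fieldCoord x₀ X (extChartAt 𝓘(ℝ, E) x₀ x) = coordAt x₀ x (X x) :=
  readIn_apply hx fun x ↦ coordAt x₀ x (X x)

lemma eventuallyEq_trivializationAt_snd {x₀ x : M} (hx : x ∈ (chartAt E x₀).source)
    (X : ∀ x : M, TangentSpace 𝓘(ℝ, E) x) :
    (fun x ↦ ((trivializationAt E (TangentSpace 𝓘(ℝ, E) : M → Type _) x₀) ⟨x, X x⟩).2)
      =ᶠ[𝓝 x] fun x ↦ coordAt x₀ x (X x) := by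
  filter_upwards [(chartAt E x₀).open_source.mem_nhds hx] with y hy
  exact trivializationAt_snd hy _

lemma contMDiffAt_field_iff {x₀ x : M} (hx : x ∈ (chartAt E x₀).source)
    {X : ∀ x : M, TangentSpace 𝓘(ℝ, E) x} {n : ℕ∞ω} :
    ContMDiffAt 𝓘(ℝ, E) (𝓘(ℝ, E).prod 𝓘(ℝ, E)) n
      (fun x ↦ (⟨x, X x⟩ : TangentBundle 𝓘(ℝ, E) M)) x ↔
      ContDiffAt ℝ n (fieldCoord x₀ X) (extChartAt 𝓘(ℝ, E) x₀ x) := by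
  have : ContMDiffVectorBundle n E (TangentSpace 𝓘(ℝ, E) : M → Type _) 𝓘(ℝ, E) := by
    have h : ContMDiffVectorBundle ω E (TangentSpace 𝓘(ℝ, E) : M → Type _) 𝓘(ℝ, E) := inferInstance
    exact ContMDiffVectorBundle.of_le le_top
  rw [fieldCoord, ← contMDiffAt_iff_readIn hx]
  refine ((trivializationAt E (TangentSpace 𝓘(ℝ, E) : M → Type _) x₀).contMDiffAt_section_iff
    (IB := 𝓘(ℝ, E)) (s := X) hx).trans ?_
  exact (eventuallyEq_trivializationAt_snd hx X).contMDiffAt_iff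

lemma mdifferentiableAt_field_iff {x₀ x : M} (hx : x ∈ (chartAt E x₀).source)
    {X : ∀ x : M, TangentSpace 𝓘(ℝ, E) x} :
    MDifferentiableAt 𝓘(ℝ, E) (𝓘(ℝ, E).prod 𝓘(ℝ, E))
      (fun x ↦ (⟨x, X x⟩ : TangentBundle 𝓘(ℝ, E) M)) x ↔
      DifferentiableAt ℝ (fieldCoord x₀ X) (extChartAt 𝓘(ℝ, E) x₀ x) := by
  rw [fieldCoord, ← mdifferentiableAt_iff_readIn hx]
  refine ((trivializationAt E (TangentSpace 𝓘(ℝ, E) : M → Type _) x₀).mdifferentiableAt_section_iff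
    𝓘(ℝ, E) X hx).trans ?_
  exact (eventuallyEq_trivializationAt_snd hx X).mdifferentiableAt_iff

lemma fieldCoord_frameAt_eventuallyEq {x₀ x : M} (hx : x ∈ (chartAt E x₀).source) (w : E) :
    fieldCoord x₀ (fun y ↦ frameAt x₀ y w) =ᶠ[𝓝 (extChartAt 𝓘(ℝ, E) x₀ x)] fun _ ↦ w := by
  filter_upwards [extChartAt_target_mem_nhds_image hx] with z hz
  refine coordAt_frameAt ?_ w
  rw [← extChartAt_source 𝓘(ℝ, E)]
  exact (extChartAt 𝓘(ℝ, E) x₀).map_target hz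

lemma contMDiffAt_frameAt {x₀ x : M} (hx : x ∈ (chartAt E x₀).source) (w : E) {n : ℕ∞ω} :
    ContMDiffAt 𝓘(ℝ, E) (𝓘(ℝ, E).prod 𝓘(ℝ, E)) n
      (fun y ↦ (⟨y, frameAt x₀ y w⟩ : TangentBundle 𝓘(ℝ, E) M)) x :=
  (contMDiffAt_field_iff hx).2
    (contDiffAt_const.congr_of_eventuallyEq (fieldCoord_frameAt_eventuallyEq hx w))

lemma mdifferentiableAt_frameAt {x₀ x : M} (hx : x ∈ (chartAt E x₀).source) (w : E) :
    MDifferentiableAt 𝓘(ℝ, E) (𝓘(ℝ, E).prod 𝓘(ℝ, E))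
      (fun y ↦ (⟨y, frameAt x₀ y w⟩ : TangentBundle 𝓘(ℝ, E) M)) x :=
  (contMDiffAt_frameAt (n := 1) hx w).mdifferentiableAt one_ne_zero

/-- The Lie bracket in coordinates. -/
lemma coordAt_mlieBracket [CompleteSpace E] {x₀ x : M} (hx : x ∈ (chartAt E x₀).source)
    {X Y : ∀ x : M, TangentSpace 𝓘(ℝ, E) x}
    (hX : DifferentiableAt ℝ (fieldCoord x₀ X) (extChartAt 𝓘(ℝ, E) x₀ x))
    (hY : DifferentiableAt ℝ (fieldCoord x₀ Y) (extChartAt 𝓘(ℝ, E) x₀ x)) :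
    coordAt x₀ x (VectorField.mlieBracket 𝓘(ℝ, E) X Y x)
      = fderiv ℝ (fieldCoord x₀ Y) (extChartAt 𝓘(ℝ, E) x₀ x) (coordAt x₀ x (X x))
        - fderiv ℝ (fieldCoord x₀ X) (extChartAt 𝓘(ℝ, E) x₀ x) (coordAt x₀ x (Y x)) := by
  let V : (∀ x : M, TangentSpace 𝓘(ℝ, E) x) → ∀ z : E, TangentSpace 𝓘(ℝ, E) z :=
    fun X ↦ fieldCoord (E := E) (M := M) x₀ X
  have hV : ∀ {X : ∀ x : M, TangentSpace 𝓘(ℝ, E) x},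
      DifferentiableAt ℝ (fieldCoord x₀ X) (extChartAt 𝓘(ℝ, E) x₀ x) →
      MDifferentiableAt 𝓘(ℝ, E) (𝓘(ℝ, E).prod 𝓘(ℝ, E))
        (fun z ↦ (⟨z, V X z⟩ : TangentBundle 𝓘(ℝ, E) E)) (extChartAt 𝓘(ℝ, E) x₀ x) := by
    intro X hX
    rw [mdifferentiableAt_section]
    simp only [trivializationAt_model_space_apply]
    exact hX.mdifferentiableAt
  have hinv : ∀ {y : M} (_ : y ∈ (chartAt E x₀).source) (w : E),
      (mfderiv 𝓘(ℝ, E) 𝓘(ℝ, E) (extChartAt 𝓘(ℝ, E) x₀) y).inverse w = frameAt x₀ y w := by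
    intro y hy w
    obtain ⟨L, hL⟩ := isInvertible_mfderiv_extChartAt (I := 𝓘(ℝ, E)) (x := x₀) (y := y)
      (by rwa [extChartAt_source])
    apply coordAt_injective hy
    rw [coordAt_frameAt hy, coordAt_eq_mfderiv hy, ← hL, ContinuousLinearMap.inverse_equiv]
    exact L.apply_symm_apply w
  -- Near `x`, every field is the pull-back under the chart of its coordinate expression, so
  -- naturality of the bracket reduces the claim to the vector space `E`.
  have hpull : ∀ X : (∀ x : M, TangentSpace 𝓘(ℝ, E) x),
      VectorField.mpullback 𝓘(ℝ, E) 𝓘(ℝ, E) (extChartAt 𝓘(ℝ, E) x₀) (V X) =ᶠ[𝓝 x] X := by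
    intro X
    filter_upwards [(chartAt E x₀).open_source.mem_nhds hx] with y hy
    exact (hinv hy _).trans
      ((congrArg (frameAt x₀ y) (fieldCoord_apply hy X)).trans (frameAt_coordAt hy _))
  have h1 := VectorField.mpullback_mlieBracket (hV hX) (hV hY)
    (contMDiffAt_extChartAt' (I := 𝓘(ℝ, E)) (n := ω) hx) (by simp)
  rw [Filter.EventuallyEq.mlieBracket_vectorField_eq (hpull X) (hpull Y)] at h1
  have h2 : VectorField.mlieBracket 𝓘(ℝ, E) (V X) (V Y) (extChartAt 𝓘(ℝ, E) x₀ x)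
      = VectorField.lieBracket ℝ (fieldCoord x₀ X) (fieldCoord x₀ Y) (extChartAt 𝓘(ℝ, E) x₀ x) := by
    rw [← VectorField.mlieBracketWithin_univ, VectorField.mlieBracketWithin_eq_lieBracketWithin,
      VectorField.lieBracketWithin_univ]
  rw [← h1, ← fieldCoord_apply hx X, ← fieldCoord_apply hx Y]
  refine (congrArg (coordAt x₀ x) (hinv hx _)).trans ((coordAt_frameAt hx _).trans h2)

end ChartCoordinates

/-! ### Christoffel symbols of a connection -/

section Christoffel

variable {E : Type*} [NormedAddCommGroup E] [NormedSpace ℝ E] [FiniteDimensional ℝ E]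
  {M : Type*} [TopologicalSpace M] [ChartedSpace E M] [IsManifold 𝓘(ℝ, E) ω M]

omit [FiniteDimensional ℝ E] in
lemma cov_sum (cov : Connection E M) {ι : Type*} (S : Finset ι)
    {t : ι → ∀ x : M, TangentSpace 𝓘(ℝ, E) x} {x : M}
    (ht : ∀ i, MDifferentiableAt 𝓘(ℝ, E) (𝓘(ℝ, E).prod 𝓘(ℝ, E))
      (fun y ↦ (⟨y, t i y⟩ : TangentBundle 𝓘(ℝ, E) M)) x) :
    cov (∑ i ∈ S, t i) x = ∑ i ∈ S, cov (t i) x := by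
  classical
  induction S using Finset.induction_on with
  | empty => simp
  | insert i S hi ih =>
    rw [Finset.sum_insert hi, Finset.sum_insert hi, ← ih]
    refine cov.isCovariantDerivativeOn.add (ht i) ?_ (Set.mem_univ x)
    have := MDifferentiableAt.sum_section (s := S) fun i _ ↦ ht i
    simpa only [Finset.sum_apply] using this

/-- The coordinates of `∇_a w` at `p`, where `w` is extended with constant coordinates. -/
def christoffelAt (cov : Connection E M) (x₀ p : M) : E →L[ℝ] E →L[ℝ] E :=
  -- Expanding `w` in a basis makes the expression linear in `w` by construction, even at points
  -- outside the chart, where the frame need not be differentiable.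
  (∑ i, (LinearMap.toContinuousLinearMap ((Module.finBasis ℝ E).coord i)).smulRight
    (coordAt x₀ p ∘L cov (fun y ↦ frameAt x₀ y (Module.finBasis ℝ E i)) p ∘L frameAt x₀ p)).flip

lemma christoffelAt_apply (cov : Connection E M) (x₀ p : M) (a w : E) :
    christoffelAt cov x₀ p a w = ∑ i, (Module.finBasis ℝ E).coord i w •
      coordAt x₀ p (cov (fun y ↦ frameAt x₀ y (Module.finBasis ℝ E i)) p (frameAt x₀ p a)) := by
  simp [christoffelAt]

/-- The Christoffel symbols of a connection in the chart at `x₀`. -/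
def christoffel (cov : Connection E M) (x₀ : M) : E → E →L[ℝ] E →L[ℝ] E :=
  readIn x₀ (christoffelAt cov x₀)

/-- The covariant derivative in coordinates. -/
lemma coordAt_cov (cov : Connection E M) {x₀ x : M} (hx : x ∈ (chartAt E x₀).source)
    {X : ∀ x : M, TangentSpace 𝓘(ℝ, E) x}
    (hX : DifferentiableAt ℝ (fieldCoord x₀ X) (extChartAt 𝓘(ℝ, E) x₀ x))
    (v : TangentSpace 𝓘(ℝ, E) x) :
    coordAt x₀ x (cov X x v)
      = fderiv ℝ (fieldCoord x₀ X) (extChartAt 𝓘(ℝ, E) x₀ x) (coordAt x₀ x v)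
        + christoffel cov x₀ (extChartAt 𝓘(ℝ, E) x₀ x) (coordAt x₀ x v) (coordAt x₀ x (X x)) := by
  let b := Module.finBasis ℝ E
  let c := fun i ↦ LinearMap.toContinuousLinearMap (b.coord i)
  let g : Fin (Module.finrank ℝ E) → M → ℝ := fun i y ↦ c i (coordAt x₀ y (X y))
  let s : Fin (Module.finrank ℝ E) → ∀ y : M, TangentSpace 𝓘(ℝ, E) y := fun i y ↦ frameAt x₀ y (b i)
  have hXm := (mdifferentiableAt_field_iff hx).2 hX
  have hgr : ∀ i, HasFDerivAt (readIn x₀ (g i))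
      (c i ∘L fderiv ℝ (fieldCoord x₀ X) (extChartAt 𝓘(ℝ, E) x₀ x)) (extChartAt 𝓘(ℝ, E) x₀ x) :=
    fun i ↦ (c i).hasFDerivAt.comp _ hX.hasFDerivAt
  have hg : ∀ i, MDifferentiableAt 𝓘(ℝ, E) 𝓘(ℝ, ℝ) (g i) x := fun i ↦
    (mdifferentiableAt_iff_readIn hx).2 (hgr i).differentiableAt
  have hs : ∀ i, MDifferentiableAt 𝓘(ℝ, E) (𝓘(ℝ, E).prod 𝓘(ℝ, E))
      (fun y ↦ (⟨y, s i y⟩ : TangentBundle 𝓘(ℝ, E) M)) x := fun i ↦ mdifferentiableAt_frameAt hx _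
  have hgs : ∀ i, MDifferentiableAt 𝓘(ℝ, E) (𝓘(ℝ, E).prod 𝓘(ℝ, E))
      (fun y ↦ (⟨y, (g i • s i) y⟩ : TangentBundle 𝓘(ℝ, E) M)) x := fun i ↦
    (hg i).smul_section (hs i)
  -- The frame expansion holds only on the chart domain; locality of the connection lets it replace
  -- `X` there, after which the Leibniz rule gives the formula.
  have hsum : ∀ᶠ y in 𝓝 x, X y = (∑ i, g i • s i) y := by
    filter_upwards [(chartAt E x₀).open_source.mem_nhds hx] with y hy
    have h1 : (∑ i, g i • s i) y = ∑ i, g i y • s i y := Finset.sum_apply y Finset.univ _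
    apply coordAt_injective hy
    rw [h1, map_sum]
    refine (b.sum_repr (coordAt x₀ y (X y))).symm.trans (Finset.sum_congr rfl fun i _ ↦ ?_)
    rw [map_smul, coordAt_frameAt hy]
    rfl
  have hcov : cov X x = ∑ i, cov (g i • s i) x := by
    rw [← cov_sum cov Finset.univ hgs]
    refine cov.isCovariantDerivativeOn.congr_of_eventuallyEq hXm ?_ Filter.univ_mem hsum
    have := MDifferentiableAt.sum_section (s := Finset.univ) fun i _ ↦ hgs i
    simpa only [Finset.sum_apply] using this
  have hterm : ∀ i, coordAt x₀ x (cov (g i • s i) x v)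
      = c i (coordAt x₀ x (X x)) • coordAt x₀ x (cov (s i) x v)
        + c i (fderiv ℝ (fieldCoord x₀ X) (extChartAt 𝓘(ℝ, E) x₀ x) (coordAt x₀ x v)) • b i := by
    intro i
    have h1 := cov.isCovariantDerivativeOn.leibniz (hs i) (hg i) (Set.mem_univ x)
    have h2 := mvfderiv_eq_fderiv_readIn hx (hg i) v
    rw [(hgr i).fderiv] at h2
    rw [show cov (g i • s i) x = _ from h1]
    simp only [_root_.add_apply, _root_.smul_apply, ContinuousLinearMap.smulRight_apply,
      map_add, map_smul, h2]
    simp only [s, coordAt_frameAt hx]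
    rfl
  rw [hcov, christoffel, readIn_apply hx, christoffelAt_apply, frameAt_coordAt hx]
  simp only [_root_.sum_apply, map_sum, hterm]
  rw [Finset.sum_add_distrib, add_comm]
  congr 1
  exact b.sum_repr _

/-- The symbols are coordinates of covariant derivatives of frame fields. These fields are analytic
on the chart domain, which is the open set to which `Connection.IsAnalytic` is applied. -/
lemma analyticAt_christoffel {cov : Connection E M} (hcov : cov.IsAnalytic) {x₀ x : M}
    (hx : x ∈ (chartAt E x₀).source) :
    AnalyticAt ℝ (christoffel cov x₀) (extChartAt 𝓘(ℝ, E) x₀ x) := by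
  have := FiniteDimensional.complete ℝ E
  have hopen := (chartAt E x₀).open_source
  refine analyticAt_clm_of_apply fun a ↦ analyticAt_clm_of_apply fun w ↦ ?_
  have hframe : ∀ w : E, ContMDiffOn 𝓘(ℝ, E) (𝓘(ℝ, E).prod 𝓘(ℝ, E)) ω
      (fun y ↦ (⟨y, frameAt x₀ y w⟩ : TangentBundle 𝓘(ℝ, E) M)) (chartAt E x₀).source :=
    fun w y hy ↦ (contMDiffAt_frameAt hy w).contMDiffWithinAt
  have h1 : ∀ u : E, ContMDiffAt 𝓘(ℝ, E) (𝓘(ℝ, E).prod 𝓘(ℝ, E)) ω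
      (fun y ↦ (⟨y, cov (fun y ↦ frameAt x₀ y u) y (frameAt x₀ y a)⟩ :
        TangentBundle 𝓘(ℝ, E) M)) x := by
    intro u
    have := ((hcov _ hopen).contMDiff (hframe u)).contMDiffAt (hopen.mem_nhds hx)
    exact ContMDiffAt.clm_bundle_apply this (contMDiffAt_frameAt hx a)
  have h2 : ∀ u : E, AnalyticAt ℝ (fieldCoord x₀ fun y ↦
      cov (fun y ↦ frameAt x₀ y u) y (frameAt x₀ y a)) (extChartAt 𝓘(ℝ, E) x₀ x) :=
    fun u ↦ ((contMDiffAt_field_iff hx).1 (h1 u)).analyticAt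
  have h3 : (fun z ↦ christoffel cov x₀ z a w) = fun z ↦ ∑ i, (Module.finBasis ℝ E).coord i w •
      fieldCoord x₀ (fun y ↦
        cov (fun y ↦ frameAt x₀ y (Module.finBasis ℝ E i)) y (frameAt x₀ y a)) z := by
    ext z
    exact christoffelAt_apply cov x₀ _ a w
  rw [h3]
  exact Finset.analyticAt_fun_sum _ fun i _ ↦ analyticAt_const.smul (h2 _)

end Christoffel

/-! ### Product rules for families of linear maps -/

section FamilyApply

variable {V W X Y : Type*} [NormedAddCommGroup V] [NormedSpace ℝ V]
  [NormedAddCommGroup W] [NormedSpace ℝ W] [NormedAddCommGroup X] [NormedSpace ℝ X]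
  [NormedAddCommGroup Y] [NormedSpace ℝ Y]

lemma hasFDerivAt_family_apply {Φ : V → W →L[ℝ] X} {w : V → W} {x : V}
    (hΦ : DifferentiableAt ℝ Φ x) (hw : DifferentiableAt ℝ w x) :
    HasFDerivAt (fun z ↦ Φ z (w z)) (Φ x ∘L fderiv ℝ w x + (fderiv ℝ Φ x).flip (w x)) x :=
  hΦ.hasFDerivAt.clm_apply hw.hasFDerivAt

lemma hasFDerivAt_apply_apply {Φ : V → W →L[ℝ] X →L[ℝ] Y} {w : V → W} {u : V → X} {x : V}
    (hΦ : DifferentiableAt ℝ Φ x) (hw : DifferentiableAt ℝ w x) (hu : DifferentiableAt ℝ u x) :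
    HasFDerivAt (fun z ↦ Φ z (w z) (u z)) (Φ x (w x) ∘L fderiv ℝ u x
      + (Φ x ∘L fderiv ℝ w x + (fderiv ℝ Φ x).flip (w x)).flip (u x)) x :=
  (hasFDerivAt_family_apply hΦ hw).clm_apply hu.hasFDerivAt

end FamilyApply

/-! ### Intrinsic tensors and their coordinate expressions -/

section Representation

variable {E : Type*} [NormedAddCommGroup E] [NormedSpace ℝ E] [FiniteDimensional ℝ E]
  {M : Type*} [TopologicalSpace M] [ChartedSpace E M] [IsManifold 𝓘(ℝ, E) ω M]

/-- `t` is the coordinate expression of the tensor field `τ` in the chart at `x₀`. -/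
def Represents (x₀ : M) {k : ℕ} (t : E → VTensor E E k) (τ : TensorField E M k) : Prop :=
  ∀ x ∈ (chartAt E x₀).source, ∀ v : Fin k → TangentSpace 𝓘(ℝ, E) x,
    coordAt x₀ x (τ x v) = t (extChartAt 𝓘(ℝ, E) x₀ x) fun i ↦ coordAt x₀ x (v i)

lemma analyticAt_fieldCoord_extend {x₀ x : M} (hx : x ∈ (chartAt E x₀).source)
    (v : TangentSpace 𝓘(ℝ, E) x) :
    AnalyticAt ℝ (fieldCoord x₀ (FiberBundle.extend E v)) (extChartAt 𝓘(ℝ, E) x₀ x) :=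
  have := FiniteDimensional.complete ℝ E
  ((contMDiffAt_field_iff hx).1 (FiberBundle.contMDiffAt_extend 𝓘(ℝ, E) E v)).analyticAt

omit [FiniteDimensional ℝ E] in
lemma fieldCoord_extend_self {x₀ x : M} (hx : x ∈ (chartAt E x₀).source)
    (v : TangentSpace 𝓘(ℝ, E) x) :
    fieldCoord x₀ (FiberBundle.extend E v) (extChartAt 𝓘(ℝ, E) x₀ x) = coordAt x₀ x v := by
  rw [fieldCoord_apply hx, FiberBundle.extend_apply_self]

/-- The extensions used by `nabla` at `x` come from the trivialization at `x`, so they are not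
constant in the chart at `x₀`. Their derivatives enter `∇(τ(X₁, …, Xₖ))` by the product rule and
cancel against those in the terms `τ(…, ∇Xᵢ, …)`. -/
lemma represents_nabla (cov : Connection E M) {x₀ : M} {k : ℕ} {t : E → VTensor E E k}
    {τ : TensorField E M k} (ht : Represents x₀ t τ)
    (hd : ∀ x ∈ (chartAt E x₀).source, DifferentiableAt ℝ t (extChartAt 𝓘(ℝ, E) x₀ x)) :
    Represents x₀ (nablaCoord (christoffel cov x₀) t) (nabla cov τ) := by
  intro x hx v
  let X : Fin k → ∀ y : M, TangentSpace 𝓘(ℝ, E) y := fun i ↦ FiberBundle.extend E (v i.succ)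
  have hX : ∀ i, HasFDerivAt (fieldCoord x₀ (X i))
      (fderiv ℝ (fieldCoord x₀ (X i)) (extChartAt 𝓘(ℝ, E) x₀ x)) (extChartAt 𝓘(ℝ, E) x₀ x) :=
    fun i ↦ (analyticAt_fieldCoord_extend hx _).differentiableAt.hasFDerivAt
  have hX0 : ∀ i, fieldCoord x₀ (X i) (extChartAt 𝓘(ℝ, E) x₀ x) = coordAt x₀ x (v i.succ) :=
    fun i ↦ fieldCoord_extend_self hx _
  have hev : fieldCoord x₀ (fun y ↦ τ y fun i ↦ X i y) =ᶠ[𝓝 (extChartAt 𝓘(ℝ, E) x₀ x)]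
      fun z ↦ t z fun i ↦ fieldCoord x₀ (X i) z := by
    filter_upwards [extChartAt_target_mem_nhds_image hx] with z hz
    have hy : (extChartAt 𝓘(ℝ, E) x₀).symm z ∈ (chartAt E x₀).source := by
      rw [← extChartAt_source 𝓘(ℝ, E)]; exact (extChartAt 𝓘(ℝ, E) x₀).map_target hz
    have := ht _ hy fun i ↦ X i ((extChartAt 𝓘(ℝ, E) x₀).symm z)
    rw [(extChartAt 𝓘(ℝ, E) x₀).right_inv hz] at this
    exact this
  have h0 := (VTensor.hasFDerivAt_eval (hd x hx).hasFDerivAt hX).congr_of_eventuallyEq hev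
  have hcov : ∀ i, coordAt x₀ x (cov (X i) x (v 0))
      = fderiv ℝ (fieldCoord x₀ (X i)) (extChartAt 𝓘(ℝ, E) x₀ x) (coordAt x₀ x (v 0))
        + christoffel cov x₀ (extChartAt 𝓘(ℝ, E) x₀ x) (coordAt x₀ x (v 0))
            (coordAt x₀ x (v i.succ)) := by
    intro i
    rw [coordAt_cov cov hx (hX i).differentiableAt]
    simp only [X, FiberBundle.extend_apply_self]
  have hupd : ∀ i, coordAt x₀ x (τ x (Function.update (fun j ↦ v j.succ) i (cov (X i) x (v 0))))
      = t (extChartAt 𝓘(ℝ, E) x₀ x) (Function.update (fun j ↦ coordAt x₀ x (v j.succ)) i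
          (fderiv ℝ (fieldCoord x₀ (X i)) (extChartAt 𝓘(ℝ, E) x₀ x) (coordAt x₀ x (v 0))))
        + t (extChartAt 𝓘(ℝ, E) x₀ x) (Function.update (fun j ↦ coordAt x₀ x (v j.succ)) i
          (christoffel cov x₀ (extChartAt 𝓘(ℝ, E) x₀ x) (coordAt x₀ x (v 0))
            (coordAt x₀ x (v i.succ)))) := by
    intro i
    have h2 : (fun j ↦ coordAt x₀ x (Function.update (fun j ↦ v j.succ) i (cov (X i) x (v 0)) j))
        = Function.update (fun j ↦ coordAt x₀ x (v j.succ)) i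
            (coordAt x₀ x (cov (X i) x (v 0))) := by
      ext j
      rcases eq_or_ne j i with rfl | hj <;> simp [*]
    rw [ht x hx, h2, hcov]
    exact (t _).toMultilinear.map_update_add _ _ _ _
  have hmain := coordAt_cov cov hx (X := fun y ↦ τ y fun i ↦ X i y) h0.differentiableAt (v 0)
  rw [h0.fderiv, ht x hx] at hmain
  have hdef : nabla cov τ x v = cov (fun y ↦ τ y fun i ↦ X i y) x (v 0)
    - ∑ i : Fin k, τ x (Function.update (fun j ↦ v j.succ) i (cov (X i) x (v 0))) := rfl
  rw [hdef, map_sub, map_sum, hmain]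
  simp only [hupd, Finset.sum_add_distrib, nablaCoord_apply, hX0, X, FiberBundle.extend_apply_self,
    _root_.add_apply, _root_.sum_apply, ContinuousLinearMap.comp_apply, VTensor.evalCLM_apply]
  have hlin : ∀ i (w : E), ((t (extChartAt 𝓘(ℝ, E) x₀ x)).toMultilinear.toContinuousLinearMap
      (fun j : Fin k ↦ coordAt x₀ x (v j.succ)) i) w
      = t (extChartAt 𝓘(ℝ, E) x₀ x) (Function.update (fun j ↦ coordAt x₀ x (v j.succ)) i w) :=
    fun i w ↦ rfl
  simp only [hlin]
  abel

lemma represents_iterNabla {cov : Connection E M} (hcov : cov.IsAnalytic) {x₀ : M} {k : ℕ}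
    {t : E → VTensor E E k} {τ : TensorField E M k} (ht : Represents x₀ t τ)
    (hd : ∀ x ∈ (chartAt E x₀).source, AnalyticAt ℝ t (extChartAt 𝓘(ℝ, E) x₀ x)) (r : ℕ) :
    Represents x₀ (iterNablaCoord (christoffel cov x₀) t r) (iterNabla cov τ r) := by
  have := FiniteDimensional.complete ℝ E
  induction r with
  | zero => exact ht
  | succ r ih =>
    exact represents_nabla cov ih fun x hx ↦
      (analyticAt_iterNablaCoord (analyticAt_christoffel hcov hx) (hd x hx) r).differentiableAt

/-- By tensoriality the torsion may be evaluated on fields with constant coordinates in the chart at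
`x₀`; their bracket and derivatives vanish, leaving the antisymmetrised Christoffel symbols. -/
lemma represents_torsionField (cov : Connection E M) (x₀ : M) :
    Represents x₀ (torsionCoord (christoffel cov x₀)) (torsionField cov) := by
  have := FiniteDimensional.complete ℝ E
  intro x hx v
  let X : Fin 2 → ∀ y : M, TangentSpace 𝓘(ℝ, E) y := fun i y ↦ frameAt x₀ y (coordAt x₀ x (v i))
  have hX0 : ∀ i, X i x = v i := fun i ↦ frameAt_coordAt hx _
  have hXc : ∀ i, HasFDerivAt (fieldCoord x₀ (X i)) (0 : E →L[ℝ] E) (extChartAt 𝓘(ℝ, E) x₀ x) :=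
    fun i ↦ (hasFDerivAt_const _ _).congr_of_eventuallyEq (fieldCoord_frameAt_eventuallyEq hx _)
  have h1 : torsionField cov x v = cov (X 1) x (X 0 x) - cov (X 0) x (X 1 x)
      - VectorField.mlieBracket 𝓘(ℝ, E) (X 0) (X 1) x := by
    rw [← cov.torsion_apply (mdifferentiableAt_frameAt hx _) (mdifferentiableAt_frameAt hx _),
      frameAt_coordAt hx, frameAt_coordAt hx]
    rfl
  rw [h1, map_sub, map_sub,
    coordAt_mlieBracket hx (hXc 0).differentiableAt (hXc 1).differentiableAt,
    coordAt_cov cov hx (hXc 1).differentiableAt, coordAt_cov cov hx (hXc 0).differentiableAt,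
    torsionCoord_apply, (hXc 0).fderiv, (hXc 1).fderiv, hX0, hX0]
  simp

/-- An identity on a neighbourhood, not just at the point, is needed because the right-hand side is
differentiated again in `coordAt_cov_cov`. Analyticity of `Z` at the point spreads its
differentiability to that neighbourhood. -/
lemma fieldCoord_cov_eventuallyEq (cov : Connection E M) {x₀ x : M}
    (hx : x ∈ (chartAt E x₀).source) {Y Z : ∀ y : M, TangentSpace 𝓘(ℝ, E) y}
    (hZ : AnalyticAt ℝ (fieldCoord x₀ Z) (extChartAt 𝓘(ℝ, E) x₀ x)) :
    fieldCoord x₀ (fun y ↦ cov Z y (Y y)) =ᶠ[𝓝 (extChartAt 𝓘(ℝ, E) x₀ x)] fun z ↦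
      fderiv ℝ (fieldCoord x₀ Z) z (fieldCoord x₀ Y z)
        + christoffel cov x₀ z (fieldCoord x₀ Y z) (fieldCoord x₀ Z z) := by
  have := FiniteDimensional.complete ℝ E
  filter_upwards [extChartAt_target_mem_nhds_image hx, hZ.eventually_analyticAt] with z hz hZz
  have hy : (extChartAt 𝓘(ℝ, E) x₀).symm z ∈ (chartAt E x₀).source := by
    rw [← extChartAt_source 𝓘(ℝ, E)]; exact (extChartAt 𝓘(ℝ, E) x₀).map_target hz
  rw [← (extChartAt 𝓘(ℝ, E) x₀).right_inv hz] at hZz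
  have h := coordAt_cov cov hy hZz.differentiableAt (Y ((extChartAt 𝓘(ℝ, E) x₀).symm z))
  rw [(extChartAt 𝓘(ℝ, E) x₀).right_inv hz] at h
  exact h

/-- The second covariant derivative of a vector field in coordinates. -/
lemma coordAt_cov_cov (cov : Connection E M) {x₀ x : M}
    (hx : x ∈ (chartAt E x₀).source) {Y Z : ∀ y : M, TangentSpace 𝓘(ℝ, E) y}
    (hΓ : DifferentiableAt ℝ (christoffel cov x₀) (extChartAt 𝓘(ℝ, E) x₀ x))
    (hY : DifferentiableAt ℝ (fieldCoord x₀ Y) (extChartAt 𝓘(ℝ, E) x₀ x))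
    (hZ : AnalyticAt ℝ (fieldCoord x₀ Z) (extChartAt 𝓘(ℝ, E) x₀ x))
    (v : TangentSpace 𝓘(ℝ, E) x) {p : E} (hp : extChartAt 𝓘(ℝ, E) x₀ x = p) {a b c : E}
    (ha : coordAt x₀ x v = a) (hb : coordAt x₀ x (Y x) = b) (hc : coordAt x₀ x (Z x) = c) :
    coordAt x₀ x (cov (fun y ↦ cov Z y (Y y)) x v)
      = fderiv ℝ (fderiv ℝ (fieldCoord x₀ Z)) p a b
        + fderiv ℝ (fieldCoord x₀ Z) p (fderiv ℝ (fieldCoord x₀ Y) p a)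
        + (fderiv ℝ (christoffel cov x₀) p a b c
          + christoffel cov x₀ p (fderiv ℝ (fieldCoord x₀ Y) p a) c
          + christoffel cov x₀ p b (fderiv ℝ (fieldCoord x₀ Z) p a))
        + christoffel cov x₀ p a (fderiv ℝ (fieldCoord x₀ Z) p b + christoffel cov x₀ p b c) := by
  have := FiniteDimensional.complete ℝ E
  subst hp ha hb hc
  have hZ1 := hasFDerivAt_family_apply hZ.fderiv.differentiableAt hY
  have hΓ2 := hasFDerivAt_apply_apply hΓ hY hZ.differentiableAt
  have h1 := (hZ1.add hΓ2).congr_of_eventuallyEq (fieldCoord_cov_eventuallyEq cov hx hZ)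
  rw [coordAt_cov cov hx h1.differentiableAt, h1.fderiv, coordAt_cov cov hx hZ.differentiableAt]
  simp only [_root_.add_apply, ContinuousLinearMap.comp_apply, ContinuousLinearMap.flip_apply,
    fieldCoord_apply hx]
  abel

/-- The derivatives of the extensions drop out: second derivatives of `Z` by symmetry, the mixed
terms `Γ(X) dZ(Y)` by antisymmetrisation, and derivatives of `X` and `Y` against `∇_[X,Y] Z`. -/
lemma represents_curvatureField {cov : Connection E M} (hcov : cov.IsAnalytic) (x₀ : M) :
    Represents x₀ (curvatureCoord (christoffel cov x₀)) (curvatureField cov) := by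
  have := FiniteDimensional.complete ℝ E
  intro x hx v
  have hX : ∀ i, AnalyticAt ℝ (fieldCoord x₀ (FiberBundle.extend E (v i)))
    (extChartAt 𝓘(ℝ, E) x₀ x) := fun i ↦ analyticAt_fieldCoord_extend hx _
  have hΓ := (analyticAt_christoffel hcov hx).differentiableAt
  have hX0 : ∀ i, coordAt x₀ x (FiberBundle.extend E (v i) x) = coordAt x₀ x (v i) := fun i ↦ by
    rw [FiberBundle.extend_apply_self]
  have hsymm : IsSymmSndFDerivAt ℝ (fieldCoord x₀ (FiberBundle.extend E (v 2)))
      (extChartAt 𝓘(ℝ, E) x₀ x) :=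
    (hX 2).contDiffAt.isSymmSndFDerivAt (n := ω) (by simp)
  rw [curvatureField, curvatureAux, map_sub, map_sub,
    coordAt_cov_cov cov hx hΓ (hX 1).differentiableAt (hX 2) _ rfl (hX0 0) (hX0 1) (hX0 2),
    coordAt_cov_cov cov hx hΓ (hX 0).differentiableAt (hX 2) _ rfl (hX0 1) (hX0 0) (hX0 2),
    coordAt_cov cov hx (hX 2).differentiableAt,
    coordAt_mlieBracket hx (hX 0).differentiableAt (hX 1).differentiableAt, curvatureCoord_apply,
    hX0, hX0, hX0, hsymm.eq (coordAt x₀ x (v 0)) (coordAt x₀ x (v 1))]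
  simp only [map_sub, map_add, _root_.sub_apply]
  abel

end Representation

/-! ### Vector fields along a map and the pull-back connection -/

section FieldsAlong

variable {E : Type*} [NormedAddCommGroup E] [NormedSpace ℝ E] [FiniteDimensional ℝ E]
  {M : Type*} [TopologicalSpace M] [ChartedSpace E M] [IsManifold 𝓘(ℝ, E) ω M]
  {F : Type*} [NormedAddCommGroup F] [NormedSpace ℝ F] [FiniteDimensional ℝ F]
  {N : Type*} [TopologicalSpace N] [ChartedSpace F N] [IsManifold 𝓘(ℝ, F) ω N]

/-- The coordinate change of tangent vectors from the chart at `y₁` to the chart at `y₀`, read in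
the latter chart. -/
def coordTransition (y₀ y₁ : N) : F → F →L[ℝ] F :=
  readIn y₀ fun y ↦ coordAt y₀ y ∘L frameAt y₁ y

lemma differentiableAt_coordTransition {y₀ y₁ y : N} (h₀ : y ∈ (chartAt F y₀).source)
    (h₁ : y ∈ (chartAt F y₁).source) :
    DifferentiableAt ℝ (coordTransition y₀ y₁) (extChartAt 𝓘(ℝ, F) y₀ y) := by
  have := FiniteDimensional.complete ℝ F
  refine (analyticAt_clm_of_apply fun w ↦ ?_).differentiableAt
  exact ((contMDiffAt_field_iff (n := ω) h₀).1 (contMDiffAt_frameAt h₁ w)).analyticAt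

omit [FiniteDimensional ℝ E] [FiniteDimensional ℝ F] in
/-- The differential of a map in coordinates. -/
lemma coordAt_mfderiv {f : M → N} {x₀ x : M} {y₀ : N} (hx : x ∈ (chartAt E x₀).source)
    (hy : f x ∈ (chartAt F y₀).source) (hf : MDifferentiableAt 𝓘(ℝ, E) 𝓘(ℝ, F) f x)
    (v : TangentSpace 𝓘(ℝ, E) x) :
    coordAt y₀ (f x) (mfderiv 𝓘(ℝ, E) 𝓘(ℝ, F) f x v)
      = fderiv ℝ (readIn x₀ (extChartAt 𝓘(ℝ, F) y₀ ∘ f)) (extChartAt 𝓘(ℝ, E) x₀ x)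
          (coordAt x₀ x v) := by
  have h1 : MDifferentiableAt 𝓘(ℝ, F) 𝓘(ℝ, F) (extChartAt 𝓘(ℝ, F) y₀) (f x) :=
    mdifferentiableAt_extChartAt hy
  have h2 := mfderiv_comp x h1 hf
  rw [← mvfderiv_eq_fderiv_readIn hx (h1.comp x hf), coordAt_eq_mfderiv hy]
  exact (congrArg (fun L ↦ L v) h2).symm

omit [FiniteDimensional ℝ F] in
lemma coordTransition_apply {y₀ y₁ y : N} (h₀ : y ∈ (chartAt F y₀).source)
    (h₁ : y ∈ (chartAt F y₁).source) (v : TangentSpace 𝓘(ℝ, F) y) :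
    coordTransition y₀ y₁ (extChartAt 𝓘(ℝ, F) y₀ y) (coordAt y₁ y v) = coordAt y₀ y v := by
  rw [coordTransition, readIn_apply h₀, ContinuousLinearMap.comp_apply, frameAt_coordAt h₁]

omit [FiniteDimensional ℝ E] in
/-- The covariant derivative of a vector field along a map, in coordinates. -/
lemma coordAt_covAlong (cov : Connection F N) {f : M → N} {x₀ x : M} {y₀ : N}
    {s : ∀ x : M, TangentSpace 𝓘(ℝ, F) (f x)} (hx : x ∈ (chartAt E x₀).source)
    (hy : f x ∈ (chartAt F y₀).source) (hf : MDifferentiableAt 𝓘(ℝ, E) 𝓘(ℝ, F) f x)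
    (hs : DifferentiableAt ℝ (readIn x₀ fun x ↦ coordAt y₀ (f x) (s x))
      (extChartAt 𝓘(ℝ, E) x₀ x)) (v : TangentSpace 𝓘(ℝ, E) x) :
    coordAt y₀ (f x) (covAlong cov f s x v)
      = fderiv ℝ (readIn x₀ fun x ↦ coordAt y₀ (f x) (s x)) (extChartAt 𝓘(ℝ, E) x₀ x)
          (coordAt x₀ x v)
        + christoffel cov y₀ (extChartAt 𝓘(ℝ, F) y₀ (f x))
            (coordAt y₀ (f x) (mfderiv 𝓘(ℝ, E) 𝓘(ℝ, F) f x v)) (coordAt y₀ (f x) (s x)) := by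
  set p := extChartAt 𝓘(ℝ, E) x₀ x with hp
  have hy' : f x ∈ (chartAt F (f x)).source := mem_chart_source F (f x)
  have hread : ∀ y : N, f x ∈ (chartAt F y).source →
      DifferentiableAt ℝ (readIn x₀ (extChartAt 𝓘(ℝ, F) y ∘ f)) p := fun y hy ↦
    (mdifferentiableAt_iff_readIn hx).1 ((mdifferentiableAt_extChartAt hy).comp x hf)
  have hreadp : ∀ y : N, readIn x₀ (extChartAt 𝓘(ℝ, F) y ∘ f) p = extChartAt 𝓘(ℝ, F) y (f x) :=
    fun y ↦ readIn_apply hx _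
  let S : N → E → F := fun y ↦ readIn x₀ fun x ↦ coordAt y (f x) (s x)
  have hS : ∀ y, S y p = coordAt y (f x) (s x) := fun y ↦
    readIn_apply hx fun x ↦ coordAt y (f x) (s x)
  have hchange : ∀ y y' : N, f x ∈ (chartAt F y).source → f x ∈ (chartAt F y').source →
      S y =ᶠ[𝓝 p] fun z ↦
        coordTransition y y' (readIn x₀ (extChartAt 𝓘(ℝ, F) y ∘ f) z) (S y' z) := by
    intro y y' h h'
    have hc : ContinuousAt (f ∘ (extChartAt 𝓘(ℝ, E) x₀).symm) p :=
      ContinuousAt.comp (by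
        rw [hp, (extChartAt 𝓘(ℝ, E) x₀).left_inv (by rwa [extChartAt_source])]
        exact hf.continuousAt) (continuousAt_extChartAt_symm' (by rwa [extChartAt_source]))
    have hcp : (f ∘ (extChartAt 𝓘(ℝ, E) x₀).symm) p = f x := by
      rw [Function.comp_apply, hp, (extChartAt 𝓘(ℝ, E) x₀).left_inv (by rwa [extChartAt_source])]
    filter_upwards [hc.preimage_mem_nhds (by rw [hcp]; exact (chartAt F y).open_source.mem_nhds h),
      hc.preimage_mem_nhds (by rw [hcp]; exact (chartAt F y').open_source.mem_nhds h')]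
      with z hz hz'
    exact (coordTransition_apply hz hz' _).symm
  have hd1 : DifferentiableAt ℝ (S (f x)) p := by
    refine DifferentiableAt.congr_of_eventuallyEq ?_ (hchange (f x) y₀ hy' hy)
    have hT : DifferentiableAt ℝ (fun z ↦ coordTransition (f x) y₀
        (readIn x₀ (extChartAt 𝓘(ℝ, F) (f x) ∘ f) z)) p :=
      DifferentiableAt.comp p (by rw [hreadp]; exact differentiableAt_coordTransition hy' hy)
        (hread _ hy')
    exact hT.clm_apply hs
  -- `covAlong` uses the trivialization at `f x`, the claim the chart at `y₀`. The product rule for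
  -- the coordinate change yields a derivative of the transition, which is exactly the derivative of
  -- the extended field in `hextd`.
  have hD0 : HasFDerivAt (S y₀) _ p :=
    (HasFDerivAt.clm_apply (HasFDerivAt.comp p (by
        rw [hreadp]; exact (differentiableAt_coordTransition hy hy').hasFDerivAt)
      (hread _ hy).hasFDerivAt) hd1.hasFDerivAt).congr_of_eventuallyEq (hchange y₀ (f x) hy hy')
  have hext : ∀ y ∈ (chartAt F (f x)).source,
      FiberBundle.extend F (s x) y = frameAt (f x) y (coordAt (f x) (f x) (s x)) := by
    intro y h
    rw [← trivializationAt_snd hy', frameAt, Trivialization.symmL_apply _ h]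
    rfl
  have hextd : HasFDerivAt (fieldCoord y₀ (FiberBundle.extend F (s x)))
      ((fderiv ℝ (coordTransition y₀ (f x)) (extChartAt 𝓘(ℝ, F) y₀ (f x))).flip
        (coordAt (f x) (f x) (s x))) (extChartAt 𝓘(ℝ, F) y₀ (f x)) := by
    have h1 : fieldCoord y₀ (FiberBundle.extend F (s x)) =ᶠ[𝓝 (extChartAt 𝓘(ℝ, F) y₀ (f x))]
        fun z ↦ coordTransition y₀ (f x) z (coordAt (f x) (f x) (s x)) := by
      have hc : ContinuousAt (extChartAt 𝓘(ℝ, F) y₀).symm (extChartAt 𝓘(ℝ, F) y₀ (f x)) :=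
        continuousAt_extChartAt_symm' (by rwa [extChartAt_source])
      have hm : (chartAt F (f x)).source
          ∈ 𝓝 ((extChartAt 𝓘(ℝ, F) y₀).symm (extChartAt 𝓘(ℝ, F) y₀ (f x))) := by
        rw [(extChartAt 𝓘(ℝ, F) y₀).left_inv (by rwa [extChartAt_source])]
        exact (chartAt F (f x)).open_source.mem_nhds hy'
      filter_upwards [hc.preimage_mem_nhds hm] with z hz
      exact congrArg _ (hext _ hz)
    refine HasFDerivAt.congr_of_eventuallyEq ?_ h1
    have h2 := hasFDerivAt_family_apply (differentiableAt_coordTransition hy hy')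
      (differentiableAt_const (coordAt (f x) (f x) (s x)))
    simpa using h2
  have hmv : mvfderiv 𝓘(ℝ, E) (fun x' : M ↦
      ((trivializationAt F (TangentSpace 𝓘(ℝ, F) : N → Type _) (f x)) ⟨f x', s x'⟩).2) x v
        = fderiv ℝ (S (f x)) p (coordAt x₀ x v) := by
    have h1 : (fun x' : M ↦
        ((trivializationAt F (TangentSpace 𝓘(ℝ, F) : N → Type _) (f x)) ⟨f x', s x'⟩).2)
          =ᶠ[𝓝 x] fun x' ↦ coordAt (f x) (f x') (s x') := by
      filter_upwards [hf.continuousAt.preimage_mem_nhds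
        ((chartAt F (f x)).open_source.mem_nhds hy')] with x' hx'
      exact trivializationAt_snd hx' _
    have h2 := (mdifferentiableAt_iff_readIn hx).2 hd1
    rw [← mvfderiv_eq_fderiv_readIn hx h2]
    exact DFunLike.congr_fun h1.mfderiv_eq v
  rw [covAlong, map_add, hmv, coordAt_cov cov hy hextd.differentiableAt, hextd.fderiv, ← add_assoc,
    FiberBundle.extend_apply_self]
  congr 1
  rw [coordAt_mfderiv hx hy hf, show readIn x₀ (fun x ↦ coordAt y₀ (f x) (s x)) = S y₀ from rfl,
    hD0.fderiv]
  simp only [hreadp, hS, _root_.add_apply, ContinuousLinearMap.comp_apply,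
    ContinuousLinearMap.flip_apply]
  congr 1
  rw [coordTransition, readIn_apply hy]
  rfl

end FieldsAlong

/-! ### From the coordinate solution to an affine map of manifolds -/

section LocalAffineMap

variable {E : Type*} [NormedAddCommGroup E] [NormedSpace ℝ E] [FiniteDimensional ℝ E]
  {M : Type*} [TopologicalSpace M] [ChartedSpace E M] [IsManifold 𝓘(ℝ, E) ω M]
  {F : Type*} [NormedAddCommGroup F] [NormedSpace ℝ F] [FiniteDimensional ℝ F]
  {N : Type*} [TopologicalSpace N] [ChartedSpace F N] [IsManifold 𝓘(ℝ, F) ω N]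

/-- A linear map between tangent spaces in coordinates. -/
def linearCoord {x₀ : M} {y₀ : N} (σ : TangentSpace 𝓘(ℝ, E) x₀ →ₗ[ℝ] TangentSpace 𝓘(ℝ, F) y₀) :
    E →L[ℝ] F :=
  LinearMap.toContinuousLinearMap
    ((coordAt y₀ y₀).toLinearMap ∘ₗ σ ∘ₗ (frameAt x₀ x₀).toLinearMap)

omit [FiniteDimensional ℝ F] in
lemma linearCoord_apply {x₀ : M} {y₀ : N}
    (σ : TangentSpace 𝓘(ℝ, E) x₀ →ₗ[ℝ] TangentSpace 𝓘(ℝ, F) y₀) (w : E) :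
    linearCoord σ w = coordAt y₀ y₀ (σ (frameAt x₀ x₀ w)) := rfl

omit [FiniteDimensional ℝ F] in
lemma relationDefect_eq_zero {x₀ : M} {y₀ : N}
    {σ : TangentSpace 𝓘(ℝ, E) x₀ →ₗ[ℝ] TangentSpace 𝓘(ℝ, F) y₀} {k : ℕ} {t : E → VTensor E E k}
    {t' : F → VTensor F F k} {τ : TensorField E M k} {τ' : TensorField F N k}
    (ht : Represents x₀ t τ) (ht' : Represents y₀ t' τ') (h : Relates σ τ τ') :
    relationDefect (linearCoord σ) (t (extChartAt 𝓘(ℝ, E) x₀ x₀))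
      (t' (extChartAt 𝓘(ℝ, F) y₀ y₀)) = 0 := by
  have hx := mem_chart_source E x₀
  have hy := mem_chart_source F y₀
  ext v
  have h1 := ht x₀ hx fun i ↦ frameAt x₀ x₀ (v i)
  have h2 := ht' y₀ hy fun i ↦ σ (frameAt x₀ x₀ (v i))
  simp only [coordAt_frameAt hx] at h1
  rw [← h] at h2
  rw [relationDefect_apply, VTensor.zero_apply, linearCoord_apply, ← h1, frameAt_coordAt hx, h2]
  exact sub_self _

-- The equality `y = y₀` does not identify the types of `w` and `w'` definitionally, so vectors are
-- compared in the tangent bundle; this is used for the value of `df` at `x₀`.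
omit [FiniteDimensional ℝ F] in
lemma totalSpace_mk_eq_of_coordAt_eq {y₀ y : N} (hy : y = y₀) {w : TangentSpace 𝓘(ℝ, F) y}
    {w' : TangentSpace 𝓘(ℝ, F) y₀} (h : coordAt y₀ y w = coordAt y₀ y₀ w') :
    (⟨y, w⟩ : TangentBundle 𝓘(ℝ, F) N) = ⟨y₀, w'⟩ := by
  subst hy
  rw [coordAt_injective (mem_chart_source F y) h]

/-- A map which satisfies the equation of affine maps in coordinates is affine. -/
lemma isAffineOn_of_coord {covM : Connection E M} {covN : Connection F N} {x₀ : M} {y₀ : N}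
    {f : M → N} {g : E → F} {U : Set M} (hU : IsOpen U) (hUx : U ⊆ (chartAt E x₀).source)
    (hUy : ∀ x ∈ U, f x ∈ (chartAt F y₀).source)
    (hfg : ∀ x ∈ U, extChartAt 𝓘(ℝ, F) y₀ (f x) = g (extChartAt 𝓘(ℝ, E) x₀ x))
    (hf : ContMDiffOn 𝓘(ℝ, E) 𝓘(ℝ, F) ω f U)
    (hg : ∀ x ∈ U, AnalyticAt ℝ g (extChartAt 𝓘(ℝ, E) x₀ x))
    (heq : ∀ x ∈ U, ∀ v w, fderiv ℝ (fderiv ℝ g) (extChartAt 𝓘(ℝ, E) x₀ x) v w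
        + christoffel covN y₀ (g (extChartAt 𝓘(ℝ, E) x₀ x))
          (fderiv ℝ g (extChartAt 𝓘(ℝ, E) x₀ x) v) (fderiv ℝ g (extChartAt 𝓘(ℝ, E) x₀ x) w)
      = fderiv ℝ g (extChartAt 𝓘(ℝ, E) x₀ x)
          (christoffel covM x₀ (extChartAt 𝓘(ℝ, E) x₀ x) v w)) :
    IsAffineOn covM covN f U ∧ ∀ x ∈ U, ∀ v, coordAt y₀ (f x) (mfderiv 𝓘(ℝ, E) 𝓘(ℝ, F) f x v)
      = fderiv ℝ g (extChartAt 𝓘(ℝ, E) x₀ x) (coordAt x₀ x v) := by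
  have := FiniteDimensional.complete ℝ E
  have := FiniteDimensional.complete ℝ F
  have hfd : ∀ x ∈ U, MDifferentiableAt 𝓘(ℝ, E) 𝓘(ℝ, F) f x := fun x hx ↦
    (hf.contMDiffAt (hU.mem_nhds hx)).mdifferentiableAt (by simp)
  have hUev : ∀ x ∈ U, ∀ᶠ z in 𝓝 (extChartAt 𝓘(ℝ, E) x₀ x),
      (extChartAt 𝓘(ℝ, E) x₀).symm z ∈ U ∧
        extChartAt 𝓘(ℝ, E) x₀ ((extChartAt 𝓘(ℝ, E) x₀).symm z) = z := by
    intro x hx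
    have hc : ContinuousAt (extChartAt 𝓘(ℝ, E) x₀).symm (extChartAt 𝓘(ℝ, E) x₀ x) :=
      continuousAt_extChartAt_symm' (by rw [extChartAt_source]; exact hUx hx)
    have hm : U ∈ 𝓝 ((extChartAt 𝓘(ℝ, E) x₀).symm (extChartAt 𝓘(ℝ, E) x₀ x)) := by
      rw [(extChartAt 𝓘(ℝ, E) x₀).left_inv (by rw [extChartAt_source]; exact hUx hx)]
      exact hU.mem_nhds hx
    filter_upwards [hc.preimage_mem_nhds hm, extChartAt_target_mem_nhds_image (hUx hx)] with z h1 h2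
    exact ⟨h1, (extChartAt 𝓘(ℝ, E) x₀).right_inv h2⟩
  have hdf : ∀ x ∈ U, ∀ v, coordAt y₀ (f x) (mfderiv 𝓘(ℝ, E) 𝓘(ℝ, F) f x v)
      = fderiv ℝ g (extChartAt 𝓘(ℝ, E) x₀ x) (coordAt x₀ x v) := by
    intro x hx v
    have h1 : readIn x₀ (extChartAt 𝓘(ℝ, F) y₀ ∘ f) =ᶠ[𝓝 (extChartAt 𝓘(ℝ, E) x₀ x)] g := by
      filter_upwards [hUev x hx] with z hz
      exact (hfg _ hz.1).trans (by rw [hz.2])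
    rw [coordAt_mfderiv (hUx hx) (hUy x hx) (hfd x hx), h1.fderiv_eq]
  refine ⟨⟨hf.of_le le_top, fun X hX x hx v ↦ ?_⟩, hdf⟩
  have hXd : DifferentiableAt ℝ (fieldCoord x₀ X) (extChartAt 𝓘(ℝ, E) x₀ x) :=
    ((contMDiffAt_field_iff (hUx hx)).1
      (hX.contMDiffAt (hU.mem_nhds hx))).differentiableAt (by simp)
  -- The field `df ∘ X` reads `dg(X)` in coordinates. Its derivative is a second derivative of `g`,
  -- handled by `heq`, plus `dg` of the derivative of `X`, which also occurs in `df(∇X)`.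
  have hread : (readIn x₀ fun x ↦ coordAt y₀ (f x) (mfderiv 𝓘(ℝ, E) 𝓘(ℝ, F) f x (X x)))
      =ᶠ[𝓝 (extChartAt 𝓘(ℝ, E) x₀ x)] fun z ↦ fderiv ℝ g z (fieldCoord x₀ X z) := by
    filter_upwards [hUev x hx] with z hz
    exact (hdf _ hz.1 _).trans (by rw [hz.2]; rfl)
  have hD := (hasFDerivAt_family_apply (hg x hx).fderiv.differentiableAt
    hXd).congr_of_eventuallyEq hread
  apply coordAt_injective (hUy x hx)
  rw [coordAt_covAlong covN (hUx hx) (hUy x hx) (hfd x hx) hD.differentiableAt, hD.fderiv,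
    hdf x hx, hdf x hx, hdf x hx, coordAt_cov covM (hUx hx) hXd, map_add, ← heq x hx, hfg x hx,
    fieldCoord_apply (hUx hx)]
  simp only [_root_.add_apply, ContinuousLinearMap.comp_apply, ContinuousLinearMap.flip_apply]
  abel

end LocalAffineMap

end AffineConn
end

/-! ### The local existence theorem -/

theorem theorem5p16
    {E : Type*} [NormedAddCommGroup E] [NormedSpace ℝ E] [FiniteDimensional ℝ E]
    {M : Type*} [TopologicalSpace M] [ChartedSpace E M] [IsManifold 𝓘(ℝ, E) ω M]
    {F : Type*} [NormedAddCommGroup F] [NormedSpace ℝ F] [FiniteDimensional ℝ F]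
    {N : Type*} [TopologicalSpace N] [ChartedSpace F N] [IsManifold 𝓘(ℝ, F) ω N]
    (covM : AffineConn.Connection E M) (hM : covM.IsAnalytic)
    (covN : AffineConn.Connection F N) (hN : covN.IsAnalytic)
    (x₀ : M) (y₀ : N) (σ₀ : TangentSpace 𝓘(ℝ, E) x₀ →ₗ[ℝ] TangentSpace 𝓘(ℝ, F) y₀)
    (hT : ∀ r : ℕ, AffineConn.Relates σ₀
      (AffineConn.iterNabla covM (AffineConn.torsionField covM) r)
      (AffineConn.iterNabla covN (AffineConn.torsionField covN) r))
    (hR : ∀ r : ℕ, AffineConn.Relates σ₀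
      (AffineConn.iterNabla covM (AffineConn.curvatureField covM) r)
      (AffineConn.iterNabla covN (AffineConn.curvatureField covN) r)) :
    ∃ (U : Set M) (f : M → N), IsOpen U ∧ x₀ ∈ U ∧
      ContMDiffOn 𝓘(ℝ, E) 𝓘(ℝ, F) ω f U ∧
      AffineConn.IsAffineOn covM covN f U ∧
      f x₀ = y₀ ∧
      ∀ v : TangentSpace 𝓘(ℝ, E) x₀,
        tangentMap 𝓘(ℝ, E) 𝓘(ℝ, F) f ⟨x₀, v⟩ = ⟨y₀, σ₀ v⟩ := by
  open AffineConn in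
  have := FiniteDimensional.complete ℝ E
  have := FiniteDimensional.complete ℝ F
  have hx₀ := mem_chart_source E x₀
  have hy₀ := mem_chart_source F y₀
  have hΓ := fun (x : M) (hx : x ∈ (chartAt E x₀).source) ↦ analyticAt_christoffel hM hx
  have hΓ' := fun (y : N) (hy : y ∈ (chartAt F y₀).source) ↦ analyticAt_christoffel hN hy
  obtain ⟨g, hg, hg0, hdg, heq⟩ := exists_affine_coord (hΓ x₀ hx₀) (hΓ' y₀ hy₀)
    (σ₀ := linearCoord σ₀)
    (fun r ↦ relationDefect_eq_zero
      (represents_iterNabla hM (represents_torsionField covM x₀)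
        (fun x hx ↦ analyticAt_torsionCoord (hΓ x hx)) r)
      (represents_iterNabla hN (represents_torsionField covN y₀)
        (fun y hy ↦ analyticAt_torsionCoord (hΓ' y hy)) r) (hT r))
    (fun r ↦ relationDefect_eq_zero
      (represents_iterNabla hM (represents_curvatureField hM x₀)
        (fun x hx ↦ analyticAt_curvatureCoord (hΓ x hx)) r)
      (represents_iterNabla hN (represents_curvatureField hN y₀)
        (fun y hy ↦ analyticAt_curvatureCoord (hΓ' y hy)) r) (hR r))
  have htarget : ∀ᶠ z in 𝓝 (extChartAt 𝓘(ℝ, E) x₀ x₀), g z ∈ (extChartAt 𝓘(ℝ, F) y₀).target :=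
    hg.continuousAt.eventually (by rw [hg0]; exact extChartAt_target_mem_nhds_image hy₀)
  have hall := (heq.and (hg.eventually_analyticAt.and htarget))
  have hallM := (continuousAt_extChartAt (I := 𝓘(ℝ, E)) x₀).eventually hall
  -- `U` is chosen so that, at each of its points, the chart at `x₀` is defined, `g` is analytic and
  -- satisfies the affine equation, and `g` takes values in the chart target at `y₀`. The map `f` is
  -- then `g` read back through the charts.
  obtain ⟨U, hUsub, hU, hxU⟩ := mem_nhds_iff.1
    (Filter.inter_mem ((chartAt E x₀).open_source.mem_nhds hx₀) hallM)
  have hUx : U ⊆ (chartAt E x₀).source := fun x hx ↦ (hUsub hx).1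
  have hUg : ∀ x ∈ U, g (extChartAt 𝓘(ℝ, E) x₀ x) ∈ (extChartAt 𝓘(ℝ, F) y₀).target :=
    fun x hx ↦ (hUsub hx).2.2.2
  have hf : ContMDiffOn 𝓘(ℝ, E) 𝓘(ℝ, F) ω
      (fun x ↦ (extChartAt 𝓘(ℝ, F) y₀).symm (g (extChartAt 𝓘(ℝ, E) x₀ x))) U := by
    intro x hx
    have h1 : ContMDiffAt 𝓘(ℝ, E) 𝓘(ℝ, E) ω (extChartAt 𝓘(ℝ, E) x₀) x :=
      contMDiffAt_extChartAt' (hUx hx)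
    have h2 : ContMDiffAt 𝓘(ℝ, E) 𝓘(ℝ, F) ω g (extChartAt 𝓘(ℝ, E) x₀ x) :=
      (hUsub hx).2.2.1.contDiffAt.contMDiffAt
    have h3 : ContMDiffAt 𝓘(ℝ, F) 𝓘(ℝ, F) ω (extChartAt 𝓘(ℝ, F) y₀).symm
        (g (extChartAt 𝓘(ℝ, E) x₀ x)) :=
      (contMDiffOn_extChartAt_symm y₀).contMDiffAt (extChartAt_target_mem_nhds' (hUg x hx))
    exact (h3.comp x (h2.comp x h1)).contMDiffWithinAt
  have hf0 : (extChartAt 𝓘(ℝ, F) y₀).symm (g (extChartAt 𝓘(ℝ, E) x₀ x₀)) = y₀ := by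
    rw [hg0, (extChartAt 𝓘(ℝ, F) y₀).left_inv (by rwa [extChartAt_source])]
  obtain ⟨haff, hdf⟩ := isAffineOn_of_coord (covM := covM) (covN := covN) hU hUx
    (fun x hx ↦ by
      rw [← extChartAt_source 𝓘(ℝ, F)]
      exact (extChartAt 𝓘(ℝ, F) y₀).map_target (hUg x hx))
    (fun x hx ↦ (extChartAt 𝓘(ℝ, F) y₀).right_inv (hUg x hx)) hf
    (fun x hx ↦ (hUsub hx).2.2.1) (fun x hx ↦ (hUsub hx).2.1)
  refine ⟨U, _, hU, hxU, hf, haff, hf0, fun v ↦ ?_⟩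
  refine totalSpace_mk_eq_of_coordAt_eq hf0 ?_
  refine (hdf x₀ hxU v).trans ?_
  rw [hdg, linearCoord_apply, frameAt_coordAt hx₀]
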